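/- For every real $\epsilon>0$ there is a constant $C>0$, depending only on $\epsilon$, such that the following holds. Let $p$ be a prime, let $N<p$ be a real number, let $P$ be a finite set of points of $\mathbb{F}_p^2$, and let $L$ be a finite set of lines in $\mathbb{F}_p^2$ (a line being a set $\{(x,y)\in\mathbb{F}_p^2: ax+by+c=0\}$ with $a,b,c\in\mathbb{F}_p$ and $(a,b)\neq(0,0)$), such that $|P|\leq N$ and $|L|\leq N$. Then the number of incidences $I(P,L)=|\{(q,l)\in P\times L: q\in l\}|$ satisfies $$I(P,L)\leq C\left(N^{\frac32-\frac1{662}}\right)^{1+\epsilon}.$$ -/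

import Mathlib

/-- A line in the plane `F × F` over a field `F`: the solution set of an equation
`a x + b y + c = 0` whose linear part `(a, b)` is nonzero. -/
def IsLine {F : Type*} [Field F] (l : Set (F × F)) : Prop :=
  ∃ a b c : F, (a ≠ 0 ∨ b ≠ 0) ∧ l = {x : F × F | a * x.1 + b * x.2 + c = 0}

open Classical in
/-- The number `I(P, L)` of incidences between a finite set `P` of points and a finite set `L`
of lines, that is, the number of pairs `(x, l)` in `P × L` with `x ∈ l`. -/
noncomputable def incidences {F : Type*} (P : Finset (F × F)) (L : Finset (Set (F × F))) : ℕ :=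
  ∑ x ∈ P, ∑ l ∈ L, if x ∈ l then 1 else 0

/-! After dyadic pigeonholing and deletion of low-degree vertices (`exists_regular`), every point
lies on about s lines and every line carries about t points, up to a factor Λ of logarithmic size.
The original incidence count is at most about N min(s, t) up to logarithms, so it suffices to bound
min(s, t) by a power of N slightly below 1/2.

Counting paths point–line–point–line gives a line l₀ of L with three points q₁, q₂, q₃ that are all
joined by lines of L to each point of a large set G off l₀ (`exists_collinear_triple`). With l₀ sent
to infinity, the three pencils become the level lines of x, y and x + y. Each pencil has at most m =
Λs lines, so G is a dense bipartite graph between two sets of at most m residues, with at most m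
sums along its edges. Balog–Szemerédi–Gowers (`exists_small_sumset`) yields X, Y with X + Y small
and still many points of G in X × Y. A popular centre q₀ joined to many of these points
(`exists_popular_center`), moved to the origin, adds a multiplicative condition: the lines through
q₀ give at most m values of y/x.

Small sumset and few ratios conflict. By Cauchy–Schwarz there are x₀ and a large Y₁ ⊆ Y such that
each y ∈ Y₁ dilates a large piece of X into x₀Y. Covering and Plünnecke–Ruzsa make (c − d)Z + (a −
b)Z small for all a, b, c, d ∈ Y₁ and some large Z ⊆ Y₁ depending on them. Let R be the set of
quotients (a − b)/(c − d). If R is closed under adding 1, it is all of F_p and contains a ratio of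
low additive energy; otherwise some r ∈ R has r + 1 ∉ R, which makes a sum map injective. Either way
the dilate sum must be large (`card_dilations_le`).

With σ = min(s, t), the resulting inequality is, up to powers of Λ, σ^317 ≲ N^158 or σ^315 ≲ N^157.
Both exponents 158/317 and 157/315 lie below 165/331, and the gap absorbs the logarithms, so the
bound holds even with ε = 0. -/

section PointsAndLines

open Finset Pointwise

/-! ### Plünnecke inequalities and covering in abelian groups -/

/-- Plünnecke's inequality with two different summands. -/
theorem exists_subset_card_add_add_le {G : Type*} [AddCommGroup G] [DecidableEq G]
    {A B₁ B₂ : Finset G} (hA : A.Nonempty) (h₁ : B₁.Nonempty) (h₂ : B₂.Nonempty) :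
    ∃ X ⊆ A, X.Nonempty ∧
      #(X + B₁ + B₂) * #A ^ 2 ≤ 4 * #(A + B₁) * #(A + B₂) * #X := by
  set u := #(A + B₁) with hu
  set v := #(A + B₂) with hv
  have hu0 : 0 < u := (hA.add h₁).card_pos
  have hv0 : 0 < v := (hA.add h₂).card_pos
  -- The extra integer coordinate balances the two summands: |H₁| = v and |H₂| = u make both A + Bᵢ
  -- contribute uv. Since H₁ is an interval of length v and H₂ consists of multiples of v, H₁ + H₂
  -- has full size uv, which cancels at the end.
  set H₁ : Finset ℤ := (range v).image (fun i : ℕ => (i : ℤ)) with hH₁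
  set H₂ : Finset ℤ := (range u).image (fun j : ℕ => ((v * j : ℕ) : ℤ)) with hH₂
  have cH₁ : #H₁ = v := by
    rw [hH₁, card_image_of_injective _ Nat.cast_injective, card_range]
  have cH₂ : #H₂ = u := by
    rw [hH₂, card_image_of_injective, card_range]
    intro i j hij
    have : v * i = v * j := Int.ofNat_inj.1 hij
    exact Nat.eq_of_mul_eq_mul_left hv0 this
  have cH : v * u ≤ #(H₂ + H₁) := by
    have : #((range u ×ˢ range v).image (fun q : ℕ × ℕ => ((v * q.1 + q.2 : ℕ) : ℤ)))
        = v * u := by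
      rw [card_image_of_injOn, card_product, card_range, card_range, mul_comm]
      rintro ⟨a, b⟩ hab ⟨c, d⟩ hcd h
      simp only [coe_product, coe_range, Set.mem_prod, Set.mem_Iio] at hab hcd
      have h' : v * a + b = v * c + d := Int.ofNat_inj.1 h
      have e1 : a = c := by
        have := congrArg (· / v) h'
        simpa [Nat.mul_add_div hv0, Nat.div_eq_of_lt hab.2, Nat.div_eq_of_lt hcd.2] using this
      subst e1
      simp only [Prod.mk.injEq, true_and]
      omega
    rw [← this]
    apply card_le_card
    intro x hx
    simp only [mem_image, mem_product, mem_range] at hx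
    obtain ⟨⟨a, b⟩, ⟨ha, hb⟩, rfl⟩ := hx
    push_cast
    refine add_mem_add ?_ ?_
    · exact mem_image.2 ⟨a, mem_range.2 ha, by push_cast; rfl⟩
    · exact mem_image.2 ⟨b, mem_range.2 hb, rfl⟩
  set B : Finset (G × ℤ) := B₁ ×ˢ H₁ ∪ B₂ ×ˢ H₂ with hB
  set z : Finset ℤ := {0} with hz
  obtain ⟨X, hX, hmin⟩ := exists_min_image (A.powerset.erase ∅)
    (fun X => (#(X ×ˢ z + B) : ℚ) / #X) ⟨A, by simp [hA.ne_empty]⟩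
  simp only [mem_erase, mem_powerset, ne_eq] at hX
  have hX0 : X.Nonempty := nonempty_iff_ne_empty.2 hX.1
  have key : ∀ X' ⊆ A, #(X ×ˢ z + B) * #X' ≤ #(X' ×ˢ z + B) * #X := by
    intro X' hX'
    rcases X'.eq_empty_or_nonempty with rfl | hne
    · simp
    have := hmin X' (by simp [hX', hne.ne_empty])
    rw [div_le_div_iff₀ (by exact_mod_cast hX0.card_pos) (by exact_mod_cast hne.card_pos)] at this
    exact_mod_cast this
  have cz : ∀ X : Finset G, #(X ×ˢ z) = #X := fun X => by simp [hz]
  have pet := pluennecke_petridis_inequality_add (A := X ×ˢ z) (B := B) (B₂ ×ˢ H₂) (by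
    intro A' hA'
    have e : A' = (A'.image Prod.fst) ×ˢ z := by
      ext ⟨a, b⟩
      simp only [hz, mem_product, mem_image, Prod.exists, exists_and_right, exists_eq_right,
        mem_singleton]
      constructor
      · intro h
        have := hA' h
        simp only [hz, mem_product, mem_singleton] at this
        exact ⟨⟨b, h⟩, this.2⟩
      · rintro ⟨⟨c, hc⟩, rfl⟩
        have := hA' hc
        simp only [hz, mem_product, mem_singleton] at this
        rw [this.2] at hc
        exact hc
    have hs : A'.image Prod.fst ⊆ X := by
      intro a ha
      obtain ⟨q, hq, rfl⟩ := mem_image.1 ha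
      exact (mem_product.1 (hA' hq)).1
    have := key _ (hs.trans hX.2)
    rw [e, cz, cz]
    exact this)
  set r := #(X ×ˢ z + B) with hr
  have h1 : #(B₂ ×ˢ H₂ + X ×ˢ z) ≤ r := by
    rw [add_comm]
    exact card_le_card (add_subset_add_left subset_union_right)
  have h2 : #(X + B₁ + B₂) * (v * u) ≤ #(B₂ ×ˢ H₂ + X ×ˢ z + B) := by
    calc #(X + B₁ + B₂) * (v * u) ≤ #(X + B₁ + B₂) * #(H₂ + H₁) := by gcongr
      _ = #(B₂ ×ˢ H₂ + X ×ˢ z + B₁ ×ˢ H₁) := by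
        rw [product_add_product_comm, product_add_product_comm, card_product,
          hz, Finset.singleton_zero, add_zero]
        congr 2
        rw [add_comm B₂, add_right_comm]
      _ ≤ _ := card_le_card (add_subset_add_left subset_union_left)
  have h3 : r * #A ≤ 2 * (u * v) * #X := by
    refine (key A subset_rfl).trans ?_
    gcongr
    rw [hB, add_union]
    refine (card_union_le _ _).trans ?_
    rw [product_add_product_comm, product_add_product_comm, card_product, card_product,
      hz, Finset.singleton_zero, zero_add, zero_add, cH₁, cH₂, ← hu, ← hv]
    apply le_of_eq; ring
  refine ⟨X, hX.2, hX0, ?_⟩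
  rw [cz] at pet
  have h4 : #(X + B₁ + B₂) * (v * u) * #X ≤ r * r := by
    calc _ ≤ #(B₂ ×ˢ H₂ + X ×ˢ z + B) * #X := by gcongr
      _ ≤ _ := pet
      _ ≤ _ := by gcongr
  have hpos : 0 < (v * u) * #X := by have := hX0.card_pos; positivity
  refine Nat.le_of_mul_le_mul_left ?_ hpos
  calc (v * u) * #X * (#(X + B₁ + B₂) * #A ^ 2)
      = (#(X + B₁ + B₂) * (v * u) * #X) * #A ^ 2 := by ring
    _ ≤ (r * r) * #A ^ 2 := by gcongr
    _ = (r * #A) ^ 2 := by ring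
    _ ≤ (2 * (u * v) * #X) ^ 2 := by gcongr
    _ = _ := by ring

/-- Plünnecke's inequality with two different summands, for at least half of the set. -/
theorem exists_large_subset_card_add_add_le {G : Type*} [AddCommGroup G] [DecidableEq G]
    {A B₁ B₂ : Finset G} (hA : A.Nonempty) (h₁ : B₁.Nonempty) (h₂ : B₂.Nonempty) :
    ∃ X ⊆ A, #A ≤ 2 * #X ∧ #(X + B₁ + B₂) * #A ≤ 16 * #(A + B₁) * #(A + B₂) := by
  -- The right side is linear in |X|, so the inequality survives disjoint unions. If a maximal X
  -- missed more than half of A, the previous lemma on the remainder would enlarge it; 16 = 4 · 4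
  -- pays for |A|² ≤ 4|R|².
  obtain ⟨X, hX, hmax⟩ := exists_max_image (A.powerset.filter
    (fun X => #(X + B₁ + B₂) * #A ^ 2 ≤ 16 * #(A + B₁) * #(A + B₂) * #X)) card
    ⟨∅, by simp⟩
  simp only [mem_filter, mem_powerset] at hX hmax
  have hA0 := hA.card_pos
  refine ⟨X, hX.1, ?_, ?_⟩
  · by_contra! hlt
    set R := A \ X with hR
    have cR : #R + #X = #A := card_sdiff_add_card_eq_card hX.1
    have hRne : R.Nonempty := card_pos.1 (by omega)
    obtain ⟨Z, hZ, hZ0, hZc⟩ := exists_subset_card_add_add_le hRne h₁ h₂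
    have hRA : R ⊆ A := sdiff_subset
    have hdisj : Disjoint X Z := (disjoint_sdiff (s := X) (t := A)).mono_right hZ
    have hcu : #(X ∪ Z) = #X + #Z := card_union_of_disjoint hdisj
    have hb1 : #(R + B₁) ≤ #(A + B₁) := card_le_card (add_subset_add_right hRA)
    have hb2 : #(R + B₂) ≤ #(A + B₂) := card_le_card (add_subset_add_right hRA)
    have hZ' : #(Z + B₁ + B₂) * #A ^ 2 ≤ 16 * #(A + B₁) * #(A + B₂) * #Z := by
      have : #A ^ 2 ≤ 4 * #R ^ 2 := by
        have : #A ≤ 2 * #R := by omega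
        calc #A ^ 2 ≤ (2 * #R) ^ 2 := by gcongr
          _ = _ := by ring
      calc #(Z + B₁ + B₂) * #A ^ 2 ≤ #(Z + B₁ + B₂) * (4 * #R ^ 2) := by gcongr
        _ = 4 * (#(Z + B₁ + B₂) * #R ^ 2) := by ring
        _ ≤ 4 * (4 * #(R + B₁) * #(R + B₂) * #Z) := by gcongr
        _ ≤ 4 * (4 * #(A + B₁) * #(A + B₂) * #Z) := by gcongr
        _ = _ := by ring
    have := hmax (X ∪ Z) ⟨union_subset hX.1 (hZ.trans hRA), by
      rw [union_add, union_add, hcu]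
      calc _ ≤ (#(X + B₁ + B₂) + #(Z + B₁ + B₂)) * #A ^ 2 := by
            gcongr; exact card_union_le _ _
        _ ≤ 16 * #(A + B₁) * #(A + B₂) * #X + 16 * #(A + B₁) * #(A + B₂) * #Z := by
            rw [add_mul]; exact add_le_add hX.2 hZ'
        _ = _ := by ring⟩
    have := hZ0.card_pos
    omega
  · have hXA := card_le_card hX.1
    refine Nat.le_of_mul_le_mul_right ?_ hA0
    calc #(X + B₁ + B₂) * #A * #A = #(X + B₁ + B₂) * #A ^ 2 := by ring
      _ ≤ _ := hX.2
      _ ≤ _ := by gcongr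

/-- All but an eighth of `B₁` is covered by few translates of `-B₂`. -/
theorem exists_cover {G : Type*} [AddCommGroup G] [DecidableEq G] (B₁ : Finset G)
    {B₂ : Finset G} (h₂ : B₂.Nonempty) :
    ∃ Z ⊆ B₁, ∃ T : Finset G, 8 * #(B₁ \ Z) ≤ #B₁ ∧ Z ⊆ T - B₂ ∧ #T * #B₂ ≤ 8 * #(B₁ + B₂) := by
  classical
  rcases B₁.eq_empty_or_nonempty with rfl | h₁
  · exact ⟨∅, subset_rfl, ∅, by simp, by simp, by simp⟩
  have h20 := h₂.card_pos
  have h10 := h₁.card_pos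
  -- Greedy covering, phrased as maximality: while more than an eighth of B₁ is uncovered, averaging
  -- over t finds a translate t − B₂ containing enough new points to pay for itself.
  obtain ⟨Z, hZ, hmax⟩ := exists_max_image (B₁.powerset.filter
    (fun Z => ∃ T : Finset G, Z ⊆ T - B₂ ∧ #T * #B₂ * #B₁ ≤ 8 * #(B₁ + B₂) * #Z)) card
    ⟨∅, by simpa using ⟨∅, by simp⟩⟩
  simp only [mem_filter, mem_powerset] at hZ hmax
  obtain ⟨hZB, T, hZT, hT⟩ := hZ
  refine ⟨Z, hZB, T, ?_, hZT, ?_⟩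
  · by_contra! hlt
    set R := B₁ \ Z with hR
    have hRB : R ⊆ B₁ := sdiff_subset
    have hsum : ∑ t ∈ R + B₂, #(R.filter (fun r => t - r ∈ B₂)) = #R * #B₂ := by
      have := sum_card_bipartiteAbove_eq_sum_card_bipartiteBelow (fun (t r : G) => t - r ∈ B₂)
        (s := R + B₂) (t := R)
      simp only [bipartiteAbove, bipartiteBelow] at this
      rw [this, card_eq_sum_ones R, sum_mul]
      refine sum_congr rfl fun r hr => ?_
      rw [one_mul]
      have : (R + B₂).filter (fun t => t - r ∈ B₂) = B₂.image (fun b => r + b) := by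
        ext t
        simp only [mem_filter, mem_image]
        constructor
        · rintro ⟨-, h⟩
          exact ⟨_, h, by abel⟩
        · rintro ⟨b, hb, rfl⟩
          exact ⟨add_mem_add hr hb, by simpa using hb⟩
      rw [this, card_image_of_injective _ (add_right_injective r)]
    have hRne : (R + B₂).Nonempty := (card_pos.1 (by omega)).add h₂
    obtain ⟨t, -, ht⟩ : ∃ t ∈ R + B₂, #R * #B₂ ≤ #(R.filter (fun r => t - r ∈ B₂)) * #(R + B₂) := by
      by_contra! hcon
      have := sum_lt_sum_of_nonempty hRne hcon
      rw [← sum_mul, hsum, sum_const, smul_eq_mul, mul_comm] at this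
      exact lt_irrefl _ this
    set W := R.filter (fun r => t - r ∈ B₂) with hW
    have hWR : W ⊆ R := filter_subset _ _
    have hdisj : Disjoint Z W := (disjoint_sdiff (s := Z) (t := B₁)).mono_right hWR
    have hcu : #(Z ∪ W) = #Z + #W := card_union_of_disjoint hdisj
    have hSle : #(R + B₂) ≤ #(B₁ + B₂) := card_le_card (add_subset_add_right hRB)
    have hWbig : #B₁ * #B₂ ≤ 8 * #(B₁ + B₂) * #W := by
      calc #B₁ * #B₂ ≤ (8 * #R) * #B₂ := by gcongr
        _ = 8 * (#R * #B₂) := by ring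
        _ ≤ 8 * (#W * #(B₁ + B₂)) :=
          Nat.mul_le_mul_left 8 (ht.trans (Nat.mul_le_mul_left _ hSle))
        _ = _ := by ring
    have := hmax (Z ∪ W) ⟨union_subset hZB (hWR.trans hRB), insert t T, ?_, ?_⟩
    · have : #W = 0 := by omega
      rw [this] at hWbig
      have := Nat.mul_pos h10 h20
      omega
    · intro z hz
      rcases mem_union.1 hz with hz | hz
      · exact sub_subset_sub_right (subset_insert _ _) (hZT hz)
      · rw [mem_sub]
        exact ⟨t, mem_insert_self _ _, _, (mem_filter.1 hz).2, by abel⟩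
    · calc #(insert t T) * #B₂ * #B₁ ≤ (#T + 1) * #B₂ * #B₁ := by
            gcongr; exact card_insert_le _ _
        _ = #T * #B₂ * #B₁ + #B₁ * #B₂ := by ring
        _ ≤ 8 * #(B₁ + B₂) * #Z + 8 * #(B₁ + B₂) * #W := add_le_add hT hWbig
        _ = _ := by rw [hcu]; ring
  · refine Nat.le_of_mul_le_mul_right ?_ h10
    have := card_le_card hZB
    exact hT.trans (by gcongr)

/-! ### Dilates and the non-closed case of the pivot -/

section Pivot

variable {F : Type*} [Field F] [DecidableEq F]

/-- If the dilate `y • X` meets `x₀ • Y` in at least `Δ` points, then most of `y • Y₁` is covered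
by few translates of `-(x₀ • Y)`. -/
theorem exists_cover_dilate {X Y Y₁ U : Finset F} {x₀ y : F} {Δ : ℝ} (hΔ : 0 < Δ)
    (hY₁ : Y₁ ⊆ Y) (hy : y ≠ 0) (hUX : U ⊆ X) (hU : Δ ≤ #U)
    (hUY : ∀ u ∈ U, ∃ v ∈ Y, y * u = x₀ * v) :
    ∃ Z ⊆ Y₁, ∃ T : Finset F, 8 * #(Y₁ \ Z) ≤ #Y₁ ∧
      (∀ z ∈ Z, ∃ t ∈ T, ∃ v ∈ Y, y * z = t - x₀ * v) ∧ #T * Δ ≤ 8 * #(X + Y) := by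
  have hinj : Function.Injective (fun z : F => y * z) := mul_right_injective₀ hy
  have hUne : U.Nonempty := by
    rw [nonempty_iff_ne_empty]
    rintro rfl
    simp at hU
    linarith
  -- The dilate yU plays two roles: it lies in x₀Y, which identifies the translates, and in yX,
  -- which puts yY₁ + yU inside y(X + Y).
  obtain ⟨Z', hZ', T, h8, hT, hc⟩ := exists_cover (Y₁.image (fun z => y * z))
    (hUne.image (fun z => y * z))
  refine ⟨Y₁.filter (fun z => y * z ∈ Z'), filter_subset _ _, T, ?_, ?_, ?_⟩
  · rw [card_image_of_injective _ hinj] at h8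
    refine le_trans (Nat.mul_le_mul_left 8 ?_) h8
    refine card_le_card_of_injOn (fun z => y * z) ?_ hinj.injOn
    intro z hz
    simp only [coe_sdiff, coe_filter, Set.mem_sdiff, mem_coe, Set.mem_ofPred_eq, not_and] at hz
    simp only [coe_sdiff, Set.mem_sdiff, mem_coe]
    exact ⟨mem_image_of_mem _ hz.1, hz.2 hz.1⟩
  · intro z hz
    obtain ⟨t, ht, b, hb, htb⟩ := mem_sub.1 (hT (mem_filter.1 hz).2)
    obtain ⟨u, hu, rfl⟩ := mem_image.1 hb
    obtain ⟨v, hv, huv⟩ := hUY u hu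
    exact ⟨t, ht, v, hv, by rw [← htb, huv]⟩
  · rw [card_image_of_injective _ hinj] at hc
    have hS : #(Y₁.image (fun z => y * z) + U.image (fun z => y * z)) ≤ #(X + Y) := by
      rw [← card_image_of_injective (X + Y) hinj]
      apply card_le_card
      intro w hw
      obtain ⟨a, ha, b, hb, rfl⟩ := mem_add.1 hw
      obtain ⟨z, hz, rfl⟩ := mem_image.1 ha
      obtain ⟨u, hu, rfl⟩ := mem_image.1 hb
      exact mem_image.2 ⟨u + z, add_mem_add (hUX hu) (hY₁ hz), by ring⟩
    calc (#T : ℝ) * Δ ≤ #T * #U := by gcongr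
      _ ≤ 8 * #(Y₁.image (fun z => y * z) + U.image (fun z => y * z)) := by exact_mod_cast hc
      _ ≤ _ := by gcongr

/-- Expanding the two differences leaves four products yᵢz, each in Tᵢ − x₀Y with |Tᵢ| ≤ 8|X + Y|/Δ.
The dilate sum therefore lies in T₁ − T₂ + T₃ − T₄ + x₀(2Y − 2Y), and Plünnecke–Ruzsa bounds the
last set. Each of the four covers misses at most an eighth of Y₁, so half survives all of them. -/
theorem exists_large_subset_card_dilates_le {X Y Y₁ : Finset F} {x₀ : F} {Δ : ℝ} (hΔ : 0 < Δ)
    (hX : X.Nonempty) (hY₁ : Y₁ ⊆ Y)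
    (h : ∀ y ∈ Y₁, y ≠ 0 ∧ ∃ U ⊆ X, Δ ≤ #U ∧ ∀ u ∈ U, ∃ v ∈ Y, y * u = x₀ * v)
    {y₁ y₂ y₃ y₄ : F} (h₁ : y₁ ∈ Y₁) (h₂ : y₂ ∈ Y₁) (h₃ : y₃ ∈ Y₁) (h₄ : y₄ ∈ Y₁) :
    ∃ Z ⊆ Y₁, #Y₁ ≤ 2 * #Z ∧
      #(image₂ (fun z z' => (y₃ - y₄) * z + (y₁ - y₂) * z') Z Z) * Δ ^ 4 * (#X : ℝ) ^ 3
        ≤ 4096 * (#(X + Y) : ℝ) ^ 8 := by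
  have key : ∀ y ∈ Y₁, ∃ Z ⊆ Y₁, ∃ T : Finset F, 8 * #(Y₁ \ Z) ≤ #Y₁ ∧
      (∀ z ∈ Z, ∃ t ∈ T, ∃ v ∈ Y, y * z = t - x₀ * v) ∧ #T * Δ ≤ 8 * #(X + Y) := by
    intro y hy
    obtain ⟨hy0, U, hUX, hU, hUY⟩ := h y hy
    exact exists_cover_dilate hΔ hY₁ hy0 hUX hU hUY
  obtain ⟨Z₁, hZ₁, T₁, c₁, m₁, b₁⟩ := key y₁ h₁
  obtain ⟨Z₂, hZ₂, T₂, c₂, m₂, b₂⟩ := key y₂ h₂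
  obtain ⟨Z₃, hZ₃, T₃, c₃, m₃, b₃⟩ := key y₃ h₃
  obtain ⟨Z₄, hZ₄, T₄, c₄, m₄, b₄⟩ := key y₄ h₄
  set Z := Y₁.filter (fun z => z ∈ Z₁ ∧ z ∈ Z₂ ∧ z ∈ Z₃ ∧ z ∈ Z₄) with hZ
  have hZY : Z ⊆ Y₁ := filter_subset _ _
  refine ⟨Z, hZY, ?_, ?_⟩
  · have e : Y₁ \ Z ⊆ (Y₁ \ Z₁ ∪ Y₁ \ Z₂) ∪ (Y₁ \ Z₃ ∪ Y₁ \ Z₄) := by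
      intro z hz
      simp only [hZ, mem_sdiff, mem_filter, mem_union] at hz ⊢
      tauto
    have e1 := card_le_card e
    have e2 := card_union_le (Y₁ \ Z₁ ∪ Y₁ \ Z₂) (Y₁ \ Z₃ ∪ Y₁ \ Z₄)
    have e3 := card_union_le (Y₁ \ Z₁) (Y₁ \ Z₂)
    have e4 := card_union_le (Y₁ \ Z₃) (Y₁ \ Z₄)
    have e5 := card_sdiff_add_card_eq_card hZY
    omega
  · set V := 2 • Y - 2 • Y with hV
    have hsub : image₂ (fun z z' => (y₃ - y₄) * z + (y₁ - y₂) * z') Z Z ⊆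
        (T₁ ×ˢ T₂ ×ˢ T₃ ×ˢ T₄ ×ˢ V).image
          (fun q => q.1 - q.2.1 + q.2.2.1 - q.2.2.2.1 + x₀ * q.2.2.2.2) := by
      intro w hw
      obtain ⟨z, hz, z', hz', rfl⟩ := mem_image₂.1 hw
      simp only [hZ, mem_filter] at hz hz'
      obtain ⟨t₁, ht₁, v₁, hv₁, e₁⟩ := m₁ z' hz'.2.1
      obtain ⟨t₂, ht₂, v₂, hv₂, e₂⟩ := m₂ z' hz'.2.2.1
      obtain ⟨t₃, ht₃, v₃, hv₃, e₃⟩ := m₃ z hz.2.2.2.1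
      obtain ⟨t₄, ht₄, v₄, hv₄, e₄⟩ := m₄ z hz.2.2.2.2
      refine mem_image.2 ⟨(t₁, t₂, t₃, t₄, (v₂ + v₄) - (v₁ + v₃)), ?_, ?_⟩
      · simp only [mem_product, ht₁, ht₂, ht₃, ht₄, true_and, hV, two_nsmul]
        exact sub_mem_sub (add_mem_add hv₂ hv₄) (add_mem_add hv₁ hv₃)
      · linear_combination e₂ + e₄ - e₁ - e₃
    have hcard := (card_le_card hsub).trans card_image_le
    simp only [card_product] at hcard
    have hpr := pluennecke_ruzsa_inequality_nsmul_sub_nsmul_add hX Y 2 2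
    have hX0 : (0 : ℝ) < #X := by exact_mod_cast hX.card_pos
    have hV' : (#V : ℝ) * (#X : ℝ) ^ 3 ≤ (#(X + Y) : ℝ) ^ 4 := by
      have : (#V : ℝ) ≤ (#(X + Y) / #X : ℝ) ^ 4 * #X := by
        have := (NNRat.cast_le (K := ℝ)).2 hpr
        push_cast at this
        exact this
      calc (#V : ℝ) * (#X : ℝ) ^ 3 ≤ ((#(X + Y) / #X : ℝ) ^ 4 * #X) * (#X : ℝ) ^ 3 := by gcongr
        _ = _ := by field_simp
    calc #(image₂ (fun z z' => (y₃ - y₄) * z + (y₁ - y₂) * z') Z Z) * Δ ^ 4 * (#X : ℝ) ^ 3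
        ≤ ((#T₁ * (#T₂ * (#T₃ * (#T₄ * #V))) : ℕ) : ℝ) * Δ ^ 4 * (#X : ℝ) ^ 3 := by
          gcongr
      _ = (#T₁ * Δ) * (#T₂ * Δ) * (#T₃ * Δ) * (#T₄ * Δ) * (#V * (#X : ℝ) ^ 3) := by
          push_cast; ring
      _ ≤ (8 * #(X + Y)) * (8 * #(X + Y)) * (8 * #(X + Y)) * (8 * #(X + Y))
            * (#(X + Y) : ℝ) ^ 4 := by gcongr
      _ = _ := by ring

/-- If `1 + (y₁ - y₂) / (y₃ - y₄)` is not a quotient of differences of `Y₁`, then `Y₁` is small. -/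
theorem card_cube_le_of_ratio_add_one_notMem {X Y Y₁ : Finset F} {x₀ : F} {Δ : ℝ} (hΔ : 0 < Δ)
    (hX : X.Nonempty) (hY₁ : Y₁ ⊆ Y)
    (h : ∀ y ∈ Y₁, y ≠ 0 ∧ ∃ U ⊆ X, Δ ≤ #U ∧ ∀ u ∈ U, ∃ v ∈ Y, y * u = x₀ * v)
    {y₁ y₂ y₃ y₄ : F} (h₁ : y₁ ∈ Y₁) (h₂ : y₂ ∈ Y₁) (h₃ : y₃ ∈ Y₁) (h₄ : y₄ ∈ Y₁)
    (h₃₄ : y₃ ≠ y₄) (hnot : ∀ a ∈ Y₁, ∀ b ∈ Y₁, ∀ c ∈ Y₁, ∀ d ∈ Y₁, c ≠ d →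
      (y₁ - y₂) / (y₃ - y₄) + 1 ≠ (a - b) / (c - d)) :
    (#Y₁ : ℝ) ^ 3 * Δ ^ 4 * (#X : ℝ) ^ 4 ≤ 2 ^ 19 * (#(X + Y) : ℝ) ^ 10 := by
  obtain ⟨Z, hZ, hZc, hW⟩ := exists_large_subset_card_dilates_le hΔ hX hY₁ h h₁ h₂ h₃ h₄
  set W := image₂ (fun z z' => (y₃ - y₄) * z + (y₁ - y₂) * z') Z Z with hWdef
  have hY₁0 : 0 < #Y₁ := card_pos.2 ⟨y₁, h₁⟩
  have hZne : Z.Nonempty := card_pos.1 (by omega)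
  have hd : y₃ - y₄ ≠ 0 := sub_ne_zero.2 h₃₄
  have hinj : Function.Injective (fun z : F => (y₃ - y₄) * z) := mul_right_injective₀ hd
  obtain ⟨A, hA, hAc, hAB⟩ := exists_large_subset_card_add_add_le
    (hZne.image (fun z => (y₃ - y₄) * z)) ((card_pos.1 hY₁0).image (fun z => (y₃ - y₄) * z))
    (hZne.image (fun z => (y₁ - y₂) * z))
  rw [card_image_of_injective _ hinj] at hAc hAB
  have e1 : #(Z.image (fun z => (y₃ - y₄) * z) + Y₁.image (fun z => (y₃ - y₄) * z))
      ≤ #(Y + Y) := by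
    rw [← card_image_of_injective (Y + Y) hinj]
    apply card_le_card
    intro w hw
    obtain ⟨a, ha, b, hb, rfl⟩ := mem_add.1 hw
    obtain ⟨z, hz, rfl⟩ := mem_image.1 ha
    obtain ⟨u, hu, rfl⟩ := mem_image.1 hb
    exact mem_image.2 ⟨z + u, add_mem_add (hY₁ (hZ hz)) (hY₁ hu), by ring⟩
  have e2 : #(Z.image (fun z => (y₃ - y₄) * z) + Z.image (fun z => (y₁ - y₂) * z)) ≤ #W := by
    apply card_le_card
    intro w hw
    obtain ⟨a, ha, b, hb, rfl⟩ := mem_add.1 hw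
    obtain ⟨z, hz, rfl⟩ := mem_image.1 ha
    obtain ⟨u, hu, rfl⟩ := mem_image.1 hb
    exact mem_image₂.2 ⟨z, hz, u, hu, rfl⟩
  -- With d = y₃ − y₄ and a = dz, the map (a, y) ↦ a + dy + ra equals d((1 + r)z + y). A collision
  -- with z ≠ z' would write 1 + r as a quotient of differences of Y₁.
  have e3 : #A * #Y₁ ≤ #(A + Y₁.image (fun z => (y₃ - y₄) * z)
      + Z.image (fun z => (y₁ - y₂) * z)) := by
    rw [← card_product]
    set r := (y₁ - y₂) / (y₃ - y₄) with hr
    have her : y₁ - y₂ = (y₃ - y₄) * r := by rw [hr]; field_simp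
    refine card_le_card_of_injOn (fun q => q.1 + (y₃ - y₄) * q.2 + r * q.1) ?_ ?_
    · rintro ⟨a, y⟩ hq
      simp only [coe_product, Set.mem_prod, mem_coe] at hq
      obtain ⟨z, hz, hza⟩ := mem_image.1 (hA hq.1)
      have : r * a = (y₁ - y₂) * z := by rw [← hza, her]; ring
      simp only [mem_coe, this]
      exact add_mem_add (add_mem_add hq.1 (mem_image_of_mem (fun z => (y₃ - y₄) * z) hq.2))
        (mem_image_of_mem (fun z => (y₁ - y₂) * z) hz)
    · rintro ⟨a, y⟩ hq ⟨a', y'⟩ hq' heq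
      simp only [coe_product, Set.mem_prod, mem_coe] at hq hq' heq
      obtain ⟨z, hz, rfl⟩ := mem_image.1 (hA hq.1)
      obtain ⟨z', hz', rfl⟩ := mem_image.1 (hA hq'.1)
      have hzz : z = z' := by
        by_contra hne
        refine hnot y hq.2 y' hq'.2 z' (hZ hz') z (hZ hz) (Ne.symm hne) ?_
        have hz0 : z' - z ≠ 0 := sub_ne_zero.2 (Ne.symm hne)
        rw [eq_div_iff hz0]
        apply mul_left_cancel₀ hd
        linear_combination -heq
      subst hzz
      have : y = y' := by
        apply mul_left_cancel₀ hd
        linear_combination heq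
      subst this
      rfl
  have hXY : #(Y + Y) * #X ≤ #(X + Y) * #(X + Y) := by
    have := ruzsa_triangle_inequality_add_add_add Y X Y
    rwa [add_comm Y X] at this
  have hnat : #Y₁ ^ 3 ≤ 128 * #(Y + Y) * #W := by
    have : #A * #Y₁ * #Z ≤ 16 * #(Y + Y) * #W := by
      calc _ ≤ _ := Nat.mul_le_mul_right #Z e3
        _ ≤ _ := hAB
        _ ≤ _ := by gcongr
    calc #Y₁ ^ 3 = #Y₁ * #Y₁ * #Y₁ := by ring
      _ ≤ (4 * #A) * #Y₁ * (2 * #Z) := by gcongr; omega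
      _ = 8 * (#A * #Y₁ * #Z) := by ring
      _ ≤ 8 * (16 * #(Y + Y) * #W) := by gcongr
      _ = _ := by ring
  have hnat' : (#Y₁ : ℝ) ^ 3 ≤ 128 * #(Y + Y) * #W := by exact_mod_cast hnat
  have hXY' : (#(Y + Y) : ℝ) * #X ≤ #(X + Y) * #(X + Y) := by exact_mod_cast hXY
  calc (#Y₁ : ℝ) ^ 3 * Δ ^ 4 * (#X : ℝ) ^ 4
      ≤ (128 * #(Y + Y) * #W) * Δ ^ 4 * (#X : ℝ) ^ 4 := by gcongr
    _ = 128 * (#(Y + Y) * #X) * (#W * Δ ^ 4 * (#X : ℝ) ^ 3) := by ring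
    _ ≤ 128 * (#(X + Y) * #(X + Y)) * (4096 * (#(X + Y) : ℝ) ^ 8) := by gcongr
    _ = _ := by ring

end Pivot

/-! ### Low-energy ratios and the sum-product pivot in F_p -/

section PrimeField

variable {p : ℕ} [Fact p.Prime]

/-- A set of residues containing `0` and closed under `+ 1` is everything. -/
theorem ZMod.mem_of_zero_mem_of_add_one {R : Set (ZMod p)} (h0 : 0 ∈ R)
    (h1 : ∀ r ∈ R, r + 1 ∈ R) (r : ZMod p) : r ∈ R := by
  have : ∀ n : ℕ, (n : ZMod p) ∈ R := by
    intro n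
    induction n with
    | zero => simpa using h0
    | succ n ih => simpa using h1 _ ih
  simpa using this r.val

/-- Some dilate of a small set of residues has small additive energy with the set. -/
theorem exists_energy_le (Y : Finset (ZMod p)) {D : ℝ} (hD : 1 ≤ D) (hY : (#Y : ℝ) ^ 2 ≤ D * p) :
    ∃ r : ZMod p, r ≠ 0 ∧
      (#((Y ×ˢ Y ×ˢ Y ×ˢ Y).filter fun q => q.1 - q.2.1 = r * (q.2.2.1 - q.2.2.2)) : ℝ)
        ≤ 3 * D * (#Y : ℝ) ^ 2 := by
  have hp : 2 ≤ p := (Fact.out : p.Prime).two_le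
  set Q := Y ×ˢ Y ×ˢ Y ×ˢ Y with hQ
  set R : Finset (ZMod p) := univ.erase 0 with hR
  have cR : #R = p - 1 := by
    rw [hR, card_erase_of_mem (mem_univ _), card_univ, ZMod.card]
  have hRne : R.Nonempty := card_pos.1 (by omega)
  have hsum : ∑ r ∈ R, #(Q.filter fun q => q.1 - q.2.1 = r * (q.2.2.1 - q.2.2.2))
      ≤ (p - 1) * #Y ^ 2 + #Y ^ 4 := by
    have := sum_card_bipartiteAbove_eq_sum_card_bipartiteBelow
      (fun (r : ZMod p) (q : ZMod p × ZMod p × ZMod p × ZMod p) =>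
        q.1 - q.2.1 = r * (q.2.2.1 - q.2.2.2)) (s := R) (t := Q)
    simp only [bipartiteAbove, bipartiteBelow] at this
    rw [this]
    -- A quadruple with equal second pair counts only if its first pair is also equal, and then for
    -- every r; any other quadruple determines r.
    calc _ ≤ ∑ q ∈ Q, ((if q.1 = q.2.1 ∧ q.2.2.1 = q.2.2.2 then p - 1 else 0) + 1) := by
          refine sum_le_sum fun q hq => ?_
          by_cases hcd : q.2.2.1 = q.2.2.2
          · by_cases hab : q.1 = q.2.1
            · rw [if_pos ⟨hab, hcd⟩]
              exact (card_filter_le _ _).trans (by omega)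
            · rw [filter_eq_empty_iff.2]
              · simp
              · intro r _ h
                rw [hcd, sub_self, mul_zero, sub_eq_zero] at h
                exact hab h
          · refine le_trans ?_ (Nat.le_add_left _ _)
            refine card_le_one.2 fun r hr r' hr' => ?_
            have h1 := (mem_filter.1 hr).2
            have h2 := (mem_filter.1 hr').2
            exact mul_right_cancel₀ (sub_ne_zero.2 hcd) (h1.symm.trans h2)
      _ = #(Q.filter fun q => q.1 = q.2.1 ∧ q.2.2.1 = q.2.2.2) * (p - 1) + #Q := by
          rw [sum_add_distrib, ← sum_filter, sum_const, sum_const, smul_eq_mul, smul_eq_mul,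
            mul_one]
      _ ≤ #Y ^ 2 * (p - 1) + #Y ^ 4 := by
          gcongr
          · rw [pow_two, ← card_product]
            refine card_le_card_of_injOn (fun q => (q.1, q.2.2.1)) ?_ ?_
            · rintro ⟨a, b, c, d⟩ h
              simp only [hQ, coe_filter, mem_product, Set.mem_ofPred_eq] at h
              simp only [coe_product, Set.mem_prod, mem_coe]
              tauto
            · rintro ⟨a, b, c, d⟩ h ⟨a', b', c', d'⟩ h' heq
              simp only [coe_filter, Set.mem_ofPred_eq, Prod.mk.injEq] at h h' heq ⊢
              obtain ⟨-, rfl, rfl⟩ := h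
              obtain ⟨-, rfl, rfl⟩ := h'
              tauto
          · apply le_of_eq
            simp only [hQ, card_product]
            ring
      _ = _ := by ring
  obtain ⟨r, hr, hle⟩ : ∃ r ∈ R,
      #(Q.filter fun q => q.1 - q.2.1 = r * (q.2.2.1 - q.2.2.2)) * (p - 1)
        ≤ (p - 1) * #Y ^ 2 + #Y ^ 4 := by
    by_contra! hcon
    have := sum_lt_sum_of_nonempty hRne hcon
    rw [← sum_mul, sum_const, smul_eq_mul, cR] at this
    have h2 := Nat.mul_le_mul_right (p - 1) hsum
    linarith [mul_comm (p - 1) ((p - 1) * #Y ^ 2 + #Y ^ 4)]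
  refine ⟨r, (mem_erase.1 hr).1, ?_⟩
  have hp1 : (1 : ℝ) ≤ ((p - 1 : ℕ) : ℝ) := by exact_mod_cast (by omega : 1 ≤ p - 1)
  have hp2 : (p : ℝ) ≤ 2 * ((p - 1 : ℕ) : ℝ) := by exact_mod_cast (by omega : p ≤ 2 * (p - 1))
  have hle' : (#(Q.filter fun q => q.1 - q.2.1 = r * (q.2.2.1 - q.2.2.2)) : ℝ) * ((p - 1 : ℕ) : ℝ)
      ≤ ((p - 1 : ℕ) : ℝ) * (#Y : ℝ) ^ 2 + (#Y : ℝ) ^ 4 := by exact_mod_cast hle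
  refine le_of_mul_le_mul_right (hle'.trans ?_) (by linarith : (0 : ℝ) < ((p - 1 : ℕ) : ℝ))
  have h4 : (#Y : ℝ) ^ 4 ≤ 2 * D * ((p - 1 : ℕ) : ℝ) * (#Y : ℝ) ^ 2 := by
    calc (#Y : ℝ) ^ 4 = (#Y : ℝ) ^ 2 * (#Y : ℝ) ^ 2 := by ring
      _ ≤ (D * p) * (#Y : ℝ) ^ 2 := by gcongr
      _ ≤ (D * (2 * ((p - 1 : ℕ) : ℝ))) * (#Y : ℝ) ^ 2 := by gcongr
      _ = _ := by ring
  have h5 : ((p - 1 : ℕ) : ℝ) * (#Y : ℝ) ^ 2 ≤ D * (((p - 1 : ℕ) : ℝ) * (#Y : ℝ) ^ 2) :=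
    le_mul_of_one_le_left (by positivity) hD
  linarith

/-- Cauchy–Schwarz over the fibres of f. -/
theorem card_sq_le_card_image_mul_card {α β : Type*} [DecidableEq β] (s : Finset α) (f : α → β) :
    #s ^ 2 ≤ #(s.image f) * #((s ×ˢ s).filter fun q => f q.1 = f q.2) := by
  have h1 : #s = ∑ b ∈ s.image f, #(s.filter fun a => f a = b) :=
    card_eq_sum_card_fiberwise fun a ha => by simpa using ⟨a, ha, rfl⟩
  have h2 : #((s ×ˢ s).filter fun q => f q.1 = f q.2)
      = ∑ b ∈ s.image f, #(s.filter fun a => f a = b) ^ 2 := by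
    rw [card_eq_sum_card_fiberwise (f := fun q => f q.1) (t := s.image f)]
    · refine sum_congr rfl fun b _ => ?_
      rw [pow_two, ← card_product]
      congr 1
      ext ⟨a, a'⟩
      simp only [mem_filter, mem_product]
      constructor
      · rintro ⟨⟨h, h'⟩, rfl⟩
        exact ⟨⟨h.1, rfl⟩, h.2, h'.symm⟩
      · rintro ⟨⟨h, rfl⟩, h', h''⟩
        exact ⟨⟨⟨h, h'⟩, h''.symm⟩, rfl⟩
    · rintro ⟨a, a'⟩ h
      simp only [coe_filter, mem_product, Set.mem_ofPred_eq] at h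
      exact mem_image_of_mem f h.1.1
  rw [h2]
  nth_rewrite 1 [h1]
  exact sq_sum_le_card_mul_sum_sq

/-- Since e = dr, a collision da + eb = dc + eg reads a − c = r(g − b), hence is counted by the
energy at ratio r. -/
theorem card_pow_four_le_energy {F : Type*} [Field F] [DecidableEq F] {Y Z : Finset F}
    (hZ : Z ⊆ Y) (d e r : F) (hd : d ≠ 0) (her : e = d * r) :
    #Z ^ 4 ≤ #(image₂ (fun z z' => d * z + e * z') Z Z) *
      #((Y ×ˢ Y ×ˢ Y ×ˢ Y).filter fun q => q.1 - q.2.1 = r * (q.2.2.1 - q.2.2.2)) := by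
  have := card_sq_le_card_image_mul_card (Z ×ˢ Z) (fun q => d * q.1 + e * q.2)
  rw [card_product] at this
  calc #Z ^ 4 = (#Z * #Z) ^ 2 := by ring
    _ ≤ _ := this
    _ ≤ _ := by
      refine Nat.mul_le_mul (le_of_eq rfl) ?_
      refine card_le_card_of_injOn (fun q => (q.1.1, q.2.1, q.2.2, q.1.2)) ?_ ?_
      · rintro ⟨⟨a, b⟩, c, g⟩ h
        simp only [coe_filter, mem_product, Set.mem_ofPred_eq] at h ⊢
        refine ⟨⟨hZ h.1.1.1, hZ h.1.2.1, hZ h.1.2.2, hZ h.1.1.2⟩, ?_⟩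
        apply mul_left_cancel₀ hd
        have := h.2
        rw [her] at this
        linear_combination this
      · rintro ⟨⟨a, b⟩, c, g⟩ _ ⟨⟨a', b'⟩, c', g'⟩ _ heq
        simp only [Prod.mk.injEq] at heq ⊢
        tauto

/-- The sum-product pivot: `Y₁` is a set of dilation factors taking a set `X` with small sumset
`X + Y` to sets which meet a fixed dilate of `Y` in at least `Δ` points. -/
theorem card_dilations_le {X Y Y₁ : Finset (ZMod p)} {x₀ : ZMod p} {Δ D : ℝ} (hΔ : 0 < Δ)
    (hD : 1 ≤ D) (hYD : (#Y₁ : ℝ) ^ 2 ≤ D * p)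
    (hX : X.Nonempty) (hY₁ : Y₁ ⊆ Y)
    (h : ∀ y ∈ Y₁, y ≠ 0 ∧ ∃ U ⊆ X, Δ ≤ #U ∧ ∀ u ∈ U, ∃ v ∈ Y, y * u = x₀ * v) :
    (#Y₁ : ℝ) ^ 3 * Δ ^ 4 * (#X : ℝ) ^ 4 ≤ 2 ^ 20 * D * (#(X + Y) : ℝ) ^ 10 := by
  rcases Y₁.eq_empty_or_nonempty with rfl | hne
  · simp; positivity
  have hYne : Y.Nonempty := hne.mono hY₁
  have hXS : (#X : ℝ) ≤ #(X + Y) := by exact_mod_cast card_le_card_add_right hYne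
  have hYS : (#Y₁ : ℝ) ≤ #(X + Y) := by
    exact_mod_cast (card_le_card hY₁).trans (card_le_card_add_left hX)
  have hS1 : (1 : ℝ) ≤ #(X + Y) := by exact_mod_cast (hX.add hYne).card_pos
  by_cases hsub : ∃ y₃ ∈ Y₁, ∃ y₄ ∈ Y₁, y₃ ≠ y₄
  swap
  · push Not at hsub
    have h1 : #Y₁ ≤ 1 := card_le_one.2 hsub
    have h1' : (#Y₁ : ℝ) ≤ 1 := by exact_mod_cast h1
    obtain ⟨y, hy⟩ := hne
    obtain ⟨-, U, hUX, hU, -⟩ := h y hy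
    have hΔX : Δ ≤ #(X + Y) := by
      have : (#U : ℝ) ≤ #X := by exact_mod_cast card_le_card hUX
      linarith
    calc (#Y₁ : ℝ) ^ 3 * Δ ^ 4 * (#X : ℝ) ^ 4
        ≤ 1 ^ 3 * (#(X + Y) : ℝ) ^ 4 * (#(X + Y) : ℝ) ^ 4 := by gcongr
      _ = 1 * 1 * (#(X + Y) : ℝ) ^ 8 := by ring
      _ ≤ 2 ^ 20 * D * (#(X + Y) : ℝ) ^ 10 := by
        gcongr
        · norm_num
        · norm_num
  obtain ⟨y₃, h₃, y₄, h₄, h₃₄⟩ := hsub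
  -- R contains 0, so closure under adding 1 forces R = F_p and makes the low-energy r available.
  -- Failure of closure is the case of `card_cube_le_of_ratio_add_one_notMem`.
  set R : Set (ZMod p) := {r | ∃ a ∈ Y₁, ∃ b ∈ Y₁, ∃ c ∈ Y₁, ∃ d ∈ Y₁, c ≠ d ∧
    r = (a - b) / (c - d)} with hR
  by_cases hclosed : ∀ r ∈ R, r + 1 ∈ R
  · have huniv := ZMod.mem_of_zero_mem_of_add_one (R := R)
      ⟨y₃, h₃, y₃, h₃, y₃, h₃, y₄, h₄, h₃₄, by simp⟩ hclosed
    obtain ⟨r, hr0, hrE⟩ := exists_energy_le Y₁ hD hYD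
    obtain ⟨a, ha, b, hb, c, hc, d, hd, hcd, hrq⟩ := huniv r
    obtain ⟨Z, hZ, hZc, hW⟩ := exists_large_subset_card_dilates_le hΔ hX hY₁ h ha hb hc hd
    have hcd0 : c - d ≠ 0 := sub_ne_zero.2 hcd
    have hE := card_pow_four_le_energy hZ (c - d) (a - b) r hcd0 (by rw [hrq]; field_simp)
    set W := image₂ (fun z z' => (c - d) * z + (a - b) * z') Z Z with hWdef
    have hk : (0 : ℝ) < #Y₁ := by exact_mod_cast hne.card_pos
    have hE' : (#Z : ℝ) ^ 4 ≤ #W * (3 * D * (#Y₁ : ℝ) ^ 2) := by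
      refine le_trans (by exact_mod_cast hE) (mul_le_mul_of_nonneg_left hrE (by positivity))
    have hZc' : (#Y₁ : ℝ) ≤ 2 * #Z := by exact_mod_cast hZc
    have hk2 : (#Y₁ : ℝ) ^ 2 ≤ 48 * D * #W := by
      refine le_of_mul_le_mul_right ?_ (pow_pos hk 2)
      calc (#Y₁ : ℝ) ^ 2 * (#Y₁ : ℝ) ^ 2 = (#Y₁ : ℝ) ^ 4 := by ring
        _ ≤ (2 * (#Z : ℝ)) ^ 4 := by gcongr
        _ = 16 * (#Z : ℝ) ^ 4 := by ring
        _ ≤ 16 * (#W * (3 * D * (#Y₁ : ℝ) ^ 2)) := by gcongr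
        _ = _ := by ring
    calc (#Y₁ : ℝ) ^ 3 * Δ ^ 4 * (#X : ℝ) ^ 4
        = (#Y₁ : ℝ) ^ 2 * Δ ^ 4 * (#X : ℝ) ^ 3 * (#Y₁ * #X) := by ring
      _ ≤ (48 * D * #W) * Δ ^ 4 * (#X : ℝ) ^ 3 * (#(X + Y) * #(X + Y)) := by gcongr
      _ = 48 * D * (#W * Δ ^ 4 * (#X : ℝ) ^ 3) * (#(X + Y) * #(X + Y)) := by ring
      _ ≤ 48 * D * (4096 * (#(X + Y) : ℝ) ^ 8) * (#(X + Y) * #(X + Y)) := by gcongr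
      _ = 196608 * D * (#(X + Y) : ℝ) ^ 10 := by ring
      _ ≤ 2 ^ 20 * D * (#(X + Y) : ℝ) ^ 10 := by gcongr; norm_num
  · push Not at hclosed
    obtain ⟨r, ⟨a, ha, b, hb, c, hc, d, hd, hcd, rfl⟩, hnot⟩ := hclosed
    refine (card_cube_le_of_ratio_add_one_notMem hΔ hX hY₁ h ha hb hc hd hcd ?_).trans ?_
    · intro a' ha' b' hb' c' hc' d' hd' hcd' heq
      exact hnot ⟨a', ha', b', hb', c', hc', d', hd', hcd', heq⟩
    · gcongr
      calc (2 : ℝ) ^ 19 ≤ 2 ^ 20 * 1 := by norm_num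
        _ ≤ 2 ^ 20 * D := by gcongr

end PrimeField

/-! ### Dependent random choice and Balog–Szemerédi–Gowers -/

section BalogSzemerediGowers

theorem sum_card_filter_comm {α β : Type*} (r : α → β → Prop) [∀ x y, Decidable (r x y)] (A : Finset α) (B : Finset β) :
    ∑ x ∈ A, #(B.filter fun y => r x y) = ∑ y ∈ B, #(A.filter fun x => r x y) := by
  have := sum_card_bipartiteAbove_eq_sum_card_bipartiteBelow r (s := A) (t := B)
  simpa only [bipartiteAbove, bipartiteBelow] using this

open Classical in
/-- Dependent random choice: in a dense bipartite graph some neighbourhood `X₀` is large and most of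
its vertices have many common neighbours with most other vertices of `X₀`. -/
theorem exists_dependent_random_choice {α β : Type*} (r : α → β → Prop) (A : Finset α)
    (B : Finset β) {m g : ℝ} (hm : 0 < m) (hg : 0 < g) (hA : #A ≤ m) (hB : #B ≤ m)
    (hE : m ^ 2 ≤ g * ∑ x ∈ A, (#(B.filter fun y => r x y) : ℝ)) :
    ∃ X₀ ⊆ A, ∃ X ⊆ X₀, m ≤ 3 * g * #X₀ ∧ #X₀ ≤ 2 * (#X : ℝ) ∧
      (∀ x ∈ X, m ≤ 2 * g * #(B.filter fun y => r x y)) ∧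
      ∀ x ∈ X, 16 * g * #(X₀.filter fun x' =>
        (#(B.filter fun y => r x y ∧ r x' y) : ℝ) < m / (256 * g ^ 3)) ≤ #X₀ := by
  set θ := m / (256 * g ^ 3) with hθ
  have hθ0 : 0 < θ := by positivity
  obtain ⟨deg, hdeg⟩ : ∃ deg : α → ℝ, ∀ x, deg x = #(B.filter fun y => r x y) :=
    ⟨_, fun _ => rfl⟩
  simp_rw [← hdeg] at hE ⊢
  -- Dropping vertices of degree below m/(2g) costs at most half of the guaranteed edges.
  set A₀ := A.filter fun x => m ≤ 2 * g * deg x with hA₀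
  obtain ⟨N, hN⟩ : ∃ N : β → Finset α, ∀ y, N y = A₀.filter fun x => r x y :=
    ⟨_, fun _ => rfl⟩
  have hA₀A : A₀ ⊆ A := filter_subset _ _
  have hA₀m : (#A₀ : ℝ) ≤ m := le_trans (by exact_mod_cast card_le_card hA₀A) hA
  have hdeg₀ : m ^ 2 ≤ 2 * g * ∑ x ∈ A₀, deg x := by
    have h1 := sum_filter_add_sum_filter_not A (fun x => m ≤ 2 * g * deg x) deg
    have h2 : 2 * g * ∑ x ∈ A.filter (fun x => ¬ m ≤ 2 * g * deg x), deg x ≤ m * m := by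
      rw [mul_sum]
      calc _ ≤ ∑ x ∈ A.filter (fun x => ¬ m ≤ 2 * g * deg x), m :=
            sum_le_sum fun x hx => le_of_not_ge (mem_filter.1 hx).2
        _ = #(A.filter (fun x => ¬ m ≤ 2 * g * deg x)) * m := by rw [sum_const, nsmul_eq_mul]
        _ ≤ m * m := by
          gcongr
          exact le_trans (by exact_mod_cast card_le_card (filter_subset _ _)) hA
    rw [← h1] at hE
    nlinarith
  have hswap : ∑ y ∈ B, (#(N y) : ℝ) = ∑ x ∈ A₀, deg x := by
    simp_rw [hN, hdeg]
    exact_mod_cast (sum_card_filter_comm r A₀ B).symm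
  have hsq : m ^ 3 ≤ 4 * g ^ 2 * ∑ y ∈ B, (#(N y) : ℝ) ^ 2 := by
    have h1 : (∑ y ∈ B, (#(N y) : ℝ)) ^ 2 ≤ m * ∑ y ∈ B, (#(N y) : ℝ) ^ 2 :=
      sq_sum_le_card_mul_sum_sq.trans
        (mul_le_mul_of_nonneg_right hB (sum_nonneg fun _ _ => sq_nonneg _))
    rw [hswap] at h1
    generalize ∑ y ∈ B, (#(N y) : ℝ) ^ 2 = n at h1 ⊢
    generalize ∑ x ∈ A₀, deg x = e at h1 hdeg₀
    refine le_of_mul_le_mul_left ?_ hm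
    calc m * m ^ 3 = (m ^ 2) ^ 2 := by ring
      _ ≤ (2 * g * e) ^ 2 := by gcongr
      _ = 4 * g ^ 2 * e ^ 2 := by ring
      _ ≤ 4 * g ^ 2 * (m * n) := by gcongr
      _ = _ := by ring
  obtain ⟨bad, hbad⟩ : ∃ bad : α → α → Prop, ∀ x x',
      bad x x' ↔ (#(B.filter fun y => r x y ∧ r x' y) : ℝ) < θ := ⟨_, fun _ _ => Iff.rfl⟩
  simp_rw [← hbad]
  set Q := (A₀ ×ˢ A₀).filter fun q => bad q.1 q.2 with hQ
  have hbadsum : ∑ y ∈ B, (#(Q.filter fun q => r q.1 y ∧ r q.2 y) : ℝ) ≤ m ^ 2 * θ := by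
    have h1 := sum_card_filter_comm (fun (q : α × α) y => r q.1 y ∧ r q.2 y) Q B
    have h2 : ∑ y ∈ B, (#(Q.filter fun q => r q.1 y ∧ r q.2 y) : ℝ)
        = ∑ q ∈ Q, (#(B.filter fun y => r q.1 y ∧ r q.2 y) : ℝ) := by exact_mod_cast h1.symm
    rw [h2]
    calc _ ≤ ∑ q ∈ Q, θ := sum_le_sum fun q hq => le_of_lt ((hbad _ _).1 (mem_filter.1 hq).2)
      _ = #Q * θ := by rw [sum_const, nsmul_eq_mul]
      _ ≤ (#A₀ * #A₀) * θ := by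
        gcongr
        exact_mod_cast (card_filter_le _ _).trans (card_product _ _).le
      _ ≤ (m * m) * θ := by gcongr
      _ = _ := by ring
  have hBne : B.Nonempty := by
    rw [nonempty_iff_ne_empty]
    rintro rfl
    rw [sum_empty, mul_zero] at hsq
    exact absurd hsq (not_le.2 (by positivity))
  -- A bad pair has fewer than θ common neighbours, so it lies in few neighbourhoods N y. The sum of
  -- |N y|² is at least m³/(4g²), and θ is chosen so that the penalty 32g · (bad pairs) totals at
  -- most half of this.
  obtain ⟨y₀, -, hy₀⟩ : ∃ y ∈ B, m ^ 2 ≤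
      8 * g ^ 2 * ((#(N y) : ℝ) ^ 2 - 32 * g * #(Q.filter fun q => r q.1 y ∧ r q.2 y)) := by
    refine exists_le_of_sum_le hBne ?_
    rw [sum_const, nsmul_eq_mul, ← mul_sum, sum_sub_distrib, ← mul_sum]
    have e : 32 * g * (m ^ 2 * θ) * (8 * g ^ 2) = m ^ 3 := by rw [hθ]; field_simp; ring
    have h3 : 8 * g ^ 2 * (32 * g * ∑ y ∈ B, (#(Q.filter fun q => r q.1 y ∧ r q.2 y) : ℝ))
        ≤ m ^ 3 := by
      rw [← e]
      calc _ ≤ 8 * g ^ 2 * (32 * g * (m ^ 2 * θ)) := by gcongr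
        _ = _ := by ring
    have h4 : #B * m ^ 2 ≤ m ^ 3 := by
      calc _ ≤ m * m ^ 2 := by gcongr
        _ = _ := by ring
    rw [mul_sub]
    linarith
  set X₀ := N y₀ with hX₀
  have hX₀A₀ : X₀ ⊆ A₀ := by rw [hX₀, hN]; exact filter_subset _ _
  obtain ⟨b, hb⟩ : ∃ b : α → ℕ, ∀ x, b x = #(X₀.filter fun x' => bad x x') :=
    ⟨_, fun _ => rfl⟩
  have hbsum : ∑ x ∈ X₀, b x = #(Q.filter fun q => r q.1 y₀ ∧ r q.2 y₀) := by
    have : Q.filter (fun q => r q.1 y₀ ∧ r q.2 y₀)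
        = (X₀ ×ˢ X₀).filter fun q => bad q.1 q.2 := by
      ext ⟨x, x'⟩
      simp only [hQ, hX₀, hN, mem_filter, mem_product]
      tauto
    rw [this, card_filter, sum_product]
    refine sum_congr rfl fun x _ => ?_
    rw [hb, card_filter]
  -- Markov: with at most |X₀|²/(32g) bad pairs, at most half of X₀ has more than |X₀|/(16g) bad
  -- partners.
  set X := X₀.filter fun x => 16 * g * (b x : ℝ) ≤ #X₀ with hX
  have hg2 : 0 < g ^ 2 := by positivity
  have hbad₀ : 32 * g * ((∑ x ∈ X₀, b x : ℕ) : ℝ) ≤ (#X₀ : ℝ) ^ 2 := by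
    rw [hbsum]
    by_contra! hlt
    nlinarith [sq_nonneg m]
  have hbig : m ≤ 3 * g * #X₀ := by
    have h0 : (0 : ℝ) ≤ 32 * g * #(Q.filter fun q => r q.1 y₀ ∧ r q.2 y₀) :=
      mul_nonneg (by positivity) (Nat.cast_nonneg _)
    have : m ^ 2 ≤ (3 * g * #X₀) ^ 2 := by
      calc m ^ 2 ≤ _ := hy₀
        _ ≤ 8 * g ^ 2 * (#X₀ : ℝ) ^ 2 := by gcongr; linarith
        _ ≤ 9 * g ^ 2 * (#X₀ : ℝ) ^ 2 := by gcongr; norm_num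
        _ = _ := by ring
    exact le_of_sq_le_sq this (by positivity)
  have hX₀pos : (0 : ℝ) < #X₀ := by
    by_contra! h
    have : 3 * g * #X₀ ≤ 0 := mul_nonpos_of_nonneg_of_nonpos (by positivity) h
    linarith
  refine ⟨X₀, hX₀A₀.trans hA₀A, X, filter_subset _ _, hbig, ?_, ?_, ?_⟩
  · have hc := card_filter_add_card_filter_not (s := X₀) (fun x => 16 * g * (b x : ℝ) ≤ #X₀)
    have hc' : (#X : ℝ) + #(X₀.filter fun x => ¬ 16 * g * (b x : ℝ) ≤ #X₀) = #X₀ := by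
      exact_mod_cast hc
    have h1 : (#(X₀.filter fun x => ¬ 16 * g * (b x : ℝ) ≤ #X₀) : ℝ) * #X₀
        ≤ 16 * g * ((∑ x ∈ X₀, b x : ℕ) : ℝ) := by
      push_cast
      rw [mul_sum]
      calc _ = ∑ x ∈ X₀.filter (fun x => ¬ 16 * g * (b x : ℝ) ≤ #X₀), (#X₀ : ℝ) := by
            rw [sum_const, nsmul_eq_mul]
        _ ≤ ∑ x ∈ X₀.filter (fun x => ¬ 16 * g * (b x : ℝ) ≤ #X₀), 16 * g * (b x : ℝ) :=
            sum_le_sum fun x hx => le_of_not_ge (mem_filter.1 hx).2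
        _ ≤ _ := sum_le_sum_of_subset_of_nonneg (filter_subset _ _) fun _ _ _ => by positivity
    nlinarith
  · intro x hx
    have := hX₀A₀ ((mem_filter.1 hx).1)
    exact (mem_filter.1 this).2
  · intro x hx
    have := (mem_filter.1 hx).2
    rw [hb] at this
    convert this

open Classical in
/-- The **Balog–Szemerédi–Gowers theorem** for sums along the edges of a bipartite graph. -/
theorem exists_small_sumset {G : Type*} [AddCommGroup G] [DecidableEq G] (r : G → G → Prop)
    (A B S : Finset G)
    {m g : ℝ} (hm : 0 < m) (hg : 0 < g) (hA : #A ≤ m) (hB : #B ≤ m) (hS : #S ≤ m)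
    (hrS : ∀ x ∈ A, ∀ y ∈ B, r x y → x + y ∈ S)
    (hE : m ^ 2 ≤ g * ∑ x ∈ A, (#(B.filter fun y => r x y) : ℝ)) :
    ∃ X ⊆ A, ∃ Y ⊆ B, m ≤ 6 * g * #X ∧
      #X * m ≤ 4 * g * ∑ x ∈ X, (#(Y.filter fun y => r x y) : ℝ) ∧
      (#(X + Y) : ℝ) * #X ≤ 4096 * g ^ 4 * m ^ 2 := by
  obtain ⟨X₀, hX₀, X, hX, hX₀m, hX₀X, hXdeg, hXbad⟩ :=
    exists_dependent_random_choice r A B hm hg hA hB hE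
  have hXA := hX.trans hX₀
  set Y := B.filter fun y => (#X : ℝ) ≤ 4 * g * #(X.filter fun x => r x y) with hY
  have hYB : Y ⊆ B := filter_subset _ _
  refine ⟨X, hXA, Y, hYB, by nlinarith, ?_, ?_⟩
  · have h1 : (#X : ℝ) * m ≤ 2 * g * ∑ y ∈ B, (#(X.filter fun x => r x y) : ℝ) := by
      have e := sum_card_filter_comm r X B
      have e' : ∑ y ∈ B, (#(X.filter fun x => r x y) : ℝ)
        = ∑ x ∈ X, (#(B.filter fun y => r x y) : ℝ) := by exact_mod_cast e.symm
      rw [e', mul_sum, ← nsmul_eq_mul, ← sum_const]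
      exact sum_le_sum hXdeg
    have h2 := sum_filter_add_sum_filter_not B
      (fun y => (#X : ℝ) ≤ 4 * g * #(X.filter fun x => r x y))
      (fun y => (#(X.filter fun x => r x y) : ℝ))
    have h3 : 4 * g * ∑ y ∈ B.filter (fun y => ¬ (#X : ℝ) ≤ 4 * g * #(X.filter fun x => r x y)),
        (#(X.filter fun x => r x y) : ℝ) ≤ m * #X := by
      rw [mul_sum]
      calc _ ≤ ∑ y ∈ B.filter (fun y => ¬ (#X : ℝ) ≤ 4 * g * #(X.filter fun x => r x y)),
            (#X : ℝ) := sum_le_sum fun x hx => le_of_not_ge (mem_filter.1 hx).2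
        _ = #(B.filter (fun y => ¬ (#X : ℝ) ≤ 4 * g * #(X.filter fun x => r x y))) * (#X : ℝ) := by
            rw [sum_const, nsmul_eq_mul]
        _ ≤ m * #X := by
          gcongr
          exact le_trans (by exact_mod_cast card_le_card (filter_subset _ _)) hB
    have h4 : ∑ y ∈ Y, (#(X.filter fun x => r x y) : ℝ)
        = ∑ x ∈ X, (#(Y.filter fun y => r x y) : ℝ) := by
      exact_mod_cast (sum_card_filter_comm r X Y).symm
    rw [← h4]
    rw [← h2] at h1
    linarith
  · set T := S ×ˢ S ×ˢ S with hT
    -- Paths of length three: x + y = (x + y') − (x' + y') + (x' + y) with all three sums in S. Here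
    -- x' is a neighbour of y not bad for x (at least |X₀|/(16g) choices), and y' is a common
    -- neighbour of x and x'. As |S|³ ≤ m³, few sums can have so many representations.
    have key : ∀ s ∈ X + Y, (#X₀ : ℝ) * m ≤
        4096 * g ^ 4 * #(T.filter fun q => q.1 - q.2.1 + q.2.2 = s) := by
      intro s hs
      obtain ⟨x, hx, y, hy, rfl⟩ := mem_add.1 hs
      set Z := X.filter fun x' => r x' y ∧
        m / (256 * g ^ 3) ≤ (#(B.filter fun y' => r x y' ∧ r x' y') : ℝ) with hZ
      have hZc : (#X₀ : ℝ) ≤ 16 * g * #Z := by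
        have h1 := (mem_filter.1 hy).2
        have h2 := hXbad x hx
        have h3 : (#(X.filter fun x' => r x' y) : ℝ) ≤ #Z + #(X₀.filter fun x' =>
            (#(B.filter fun y => r x y ∧ r x' y) : ℝ) < m / (256 * g ^ 3)) := by
          have : X.filter (fun x' => r x' y) ⊆ Z ∪ X₀.filter fun x' =>
            (#(B.filter fun y => r x y ∧ r x' y) : ℝ) < m / (256 * g ^ 3) := by
            intro x' hx'
            simp only [hZ, mem_union, mem_filter] at hx' ⊢
            by_cases h : (#(B.filter fun y => r x y ∧ r x' y) : ℝ) < m / (256 * g ^ 3)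
            · exact Or.inr ⟨hX hx'.1, h⟩
            · exact Or.inl ⟨hx'.1, hx'.2, le_of_not_gt h⟩
          exact_mod_cast (card_le_card this).trans (card_union_le _ _)
        have h4 := mul_le_mul_of_nonneg_left h3 (by positivity : 0 ≤ 16 * g)
        linarith
      have hinj : #(Z.sigma fun x' => B.filter fun y' => r x y' ∧ r x' y')
          ≤ #(T.filter fun q => q.1 - q.2.1 + q.2.2 = x + y) := by
        refine card_le_card_of_injOn (fun w => (x + w.2, w.1 + w.2, w.1 + y)) ?_ ?_
        · rintro ⟨x', y'⟩ hw
          simp only [coe_sigma, Set.mem_sigma_iff, mem_coe, hZ, mem_filter] at hw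
          simp only [coe_filter, Set.mem_ofPred_eq, hT, mem_product]
          refine ⟨⟨hrS _ (hXA hx) _ hw.2.1 hw.2.2.1, hrS _ (hXA hw.1.1) _ hw.2.1 hw.2.2.2,
            hrS _ (hXA hw.1.1) _ (hYB hy) hw.1.2.1⟩, by abel⟩
        · rintro ⟨x', y'⟩ _ ⟨x'', y''⟩ _ heq
          simp only [Prod.mk.injEq, add_right_inj, add_left_inj] at heq
          obtain ⟨rfl, -, rfl⟩ := heq
          rfl
      rw [card_sigma] at hinj
      have hinj' : ∑ x' ∈ Z, (#(B.filter fun y' => r x y' ∧ r x' y') : ℝ)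
          ≤ #(T.filter fun q => q.1 - q.2.1 + q.2.2 = x + y) := by exact_mod_cast hinj
      have hlow : #Z * (m / (256 * g ^ 3)) ≤
          ∑ x' ∈ Z, (#(B.filter fun y' => r x y' ∧ r x' y') : ℝ) := by
        rw [← nsmul_eq_mul, ← sum_const]
        exact sum_le_sum fun x' hx' => (mem_filter.1 hx').2.2
      calc (#X₀ : ℝ) * m ≤ (16 * g * #Z) * m := by gcongr
        _ = 4096 * g ^ 4 * (#Z * (m / (256 * g ^ 3))) := by field_simp; ring
        _ ≤ _ := by gcongr; exact hlow.trans hinj'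
    have hTsum : ∑ s ∈ X + Y, (#(T.filter fun q => q.1 - q.2.1 + q.2.2 = s) : ℝ) ≤ m ^ 3 := by
      have : ∑ s ∈ X + Y, #(T.filter fun q => q.1 - q.2.1 + q.2.2 = s) ≤ #T := by
        rw [← card_biUnion fun s _ s' _ hne => disjoint_filter.2 fun q _ h h' => hne (h ▸ h')]
        exact card_le_card (biUnion_subset.2 fun s _ => filter_subset _ _)
      calc _ ≤ (#T : ℝ) := by exact_mod_cast this
        _ = (#S : ℝ) * (#S * #S) := by rw [hT, card_product, card_product]; push_cast; ring
        _ ≤ m * (m * m) := by gcongr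
        _ = _ := by ring
    have htot : (#(X + Y) : ℝ) * (#X₀ * m) ≤ 4096 * g ^ 4 * m ^ 3 := by
      rw [← nsmul_eq_mul, ← sum_const]
      refine (sum_le_sum key).trans ?_
      rw [← mul_sum]
      gcongr
    have hXX₀ : (#X : ℝ) ≤ #X₀ := by exact_mod_cast card_le_card hX
    refine le_of_mul_le_mul_right ?_ hm
    calc (#(X + Y) : ℝ) * #X * m ≤ #(X + Y) * #X₀ * m := by gcongr
      _ = #(X + Y) * (#X₀ * m) := by ring
      _ ≤ _ := htot
      _ = _ := by ring

end BalogSzemerediGowers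

/-! ### Few sums against few ratios on a grid -/

section Grid

open Classical in
/-- A dense subset `Γ` of a grid `X × Y` with few sums `X + Y` determines many ratios. -/
theorem card_pow_le_of_card_ratios_le {p : ℕ} [Fact p.Prime] {X Y : Finset (ZMod p)}
    {Γ : Finset (ZMod p × ZMod p)} (hΓ : Γ ⊆ X ×ˢ Y) (hne : Γ.Nonempty)
    (h0 : ∀ q ∈ Γ, q.1 ≠ 0 ∧ q.2 ≠ 0) {m D : ℝ} (hratio : #(Γ.image fun q => q.2 / q.1) ≤ m)
    (hYm : #Y ≤ m) (hD : 1 ≤ D) (hmD : m ^ 2 ≤ D * p) :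
    (#Γ : ℝ) ^ 14 ≤ 2 ^ 27 * D * m ^ 11 * (#X : ℝ) ^ 6 * (#(X + Y) : ℝ) ^ 10 := by
  obtain ⟨w, hw⟩ : ∃ w : ZMod p → ℕ, ∀ ξ, w ξ = #(Γ.filter fun q => q.2 / q.1 = ξ) :=
    ⟨_, fun _ => rfl⟩
  have hX : X.Nonempty := by
    obtain ⟨q, hq⟩ := hne
    exact ⟨_, (mem_product.1 (hΓ hq)).1⟩
  have hτ : (0 : ℝ) < #Γ := by exact_mod_cast hne.card_pos
  have hX0 : (0 : ℝ) < #X := by exact_mod_cast hX.card_pos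
  have hcs := card_sq_le_card_image_mul_card Γ (fun q => q.2 / q.1)
  have hpairs : #((Γ ×ˢ Γ).filter fun q => q.1.2 / q.1.1 = q.2.2 / q.2.1)
      = ∑ x ∈ X, ∑ y ∈ Y.filter (fun y => (x, y) ∈ Γ), w (y / x) := by
    have h1 : #((Γ ×ˢ Γ).filter fun q => q.1.2 / q.1.1 = q.2.2 / q.2.1)
        = ∑ q ∈ Γ, w (q.2 / q.1) := by
      rw [card_filter, sum_product]
      refine sum_congr rfl fun q _ => ?_
      rw [hw, card_filter]
      exact sum_congr rfl fun q' _ => by simp only [eq_comm]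
    rw [h1]
    have h2 : Γ = (X ×ˢ Y).filter fun q => q ∈ Γ := by
      ext q
      rw [mem_filter]
      exact ⟨fun h => ⟨hΓ h, h⟩, fun h => h.2⟩
    nth_rewrite 1 [h2]
    rw [sum_filter, sum_product]
    exact sum_congr rfl fun x _ => by rw [sum_filter]
  rw [hpairs] at hcs
  -- Γ has at most m ratios, so Cauchy–Schwarz gives many pairs of equal ratio; x₀ is the abscissa
  -- whose points take part in at least the average number of them.
  obtain ⟨x₀, hx₀, hT⟩ : ∃ x ∈ X, (#Γ : ℝ) ^ 2 ≤
      m * #X * ((∑ y ∈ Y.filter (fun y => (x, y) ∈ Γ), w (y / x) : ℕ) : ℝ) := by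
    by_contra! hcon
    have := sum_lt_sum_of_nonempty hX hcon
    rw [← mul_sum, sum_const, nsmul_eq_mul] at this
    have h2 : (#Γ : ℝ) ^ 2 ≤ #(Γ.image fun q => q.2 / q.1) *
        ∑ x ∈ X, ((∑ y ∈ Y.filter (fun y => (x, y) ∈ Γ), w (y / x) : ℕ) : ℝ) := by
      exact_mod_cast hcs
    have h3 : (#Γ : ℝ) ^ 2 ≤ m *
        ∑ x ∈ X, ((∑ y ∈ Y.filter (fun y => (x, y) ∈ Γ), w (y / x) : ℕ) : ℝ) :=
      h2.trans (mul_le_mul_of_nonneg_right hratio (sum_nonneg fun _ _ => Nat.cast_nonneg _))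
    nlinarith
  set Y₀ := Y.filter fun y => (x₀, y) ∈ Γ with hY₀
  obtain ⟨T, hTdef⟩ : ∃ T : ℝ, T = ((∑ y ∈ Y₀, w (y / x₀) : ℕ) : ℝ) := ⟨_, rfl⟩
  rw [← hTdef] at hT
  have hm0 : 0 < m := by
    refine lt_of_lt_of_le ?_ hratio
    exact_mod_cast (hne.image _).card_pos
  have hT0 : 0 < T := by
    by_contra! h
    have : m * #X * T ≤ 0 := mul_nonpos_of_nonneg_of_nonpos (mul_nonneg hm0.le hX0.le) h
    nlinarith [sq_pos_of_pos hτ]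
  have hwX : ∀ ξ, w ξ ≤ #X := by
    intro ξ
    rw [hw]
    refine card_le_card_of_injOn Prod.fst ?_ ?_
    · intro q hq
      exact (mem_product.1 (hΓ (mem_filter.1 hq).1)).1
    · intro q hq q' hq' heq
      have h1 := mem_filter.1 (mem_coe.1 hq)
      have h2 := mem_filter.1 (mem_coe.1 hq')
      refine Prod.ext heq ?_
      rw [div_eq_iff (h0 _ h1.1).1] at h1
      rw [div_eq_iff (h0 _ h2.1).1] at h2
      rw [h1.2, h2.2, heq]
  -- Ratios of weight below Δ contribute at most mΔ = T/2, since there are at most m candidates y.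
  set Δ := T / (2 * m) with hΔ
  have hΔ0 : 0 < Δ := by positivity
  set Y₁ := Y₀.filter fun y => Δ ≤ w (y / x₀) with hY₁
  have hY₁Y : Y₁ ⊆ Y := (filter_subset _ _).trans (filter_subset _ _)
  have hTY : T ≤ 2 * (#X * #Y₁) := by
    have h1 := sum_filter_add_sum_filter_not Y₀ (fun y => Δ ≤ w (y / x₀))
      (fun y => (w (y / x₀) : ℝ))
    have h2 : ∑ y ∈ Y₀.filter (fun y => ¬ Δ ≤ w (y / x₀)), (w (y / x₀) : ℝ) ≤ T / 2 := by
      calc _ ≤ ∑ y ∈ Y₀.filter (fun y => ¬ Δ ≤ w (y / x₀)), Δ :=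
            sum_le_sum fun y hy => le_of_not_ge (mem_filter.1 hy).2
        _ = #(Y₀.filter (fun y => ¬ Δ ≤ w (y / x₀))) * Δ := by rw [sum_const, nsmul_eq_mul]
        _ ≤ m * Δ := by
          refine mul_le_mul_of_nonneg_right (le_trans ?_ hYm) hΔ0.le
          exact_mod_cast card_le_card ((filter_subset _ _).trans (filter_subset _ _))
        _ = T / 2 := by rw [hΔ]; field_simp
    have h3 : ∑ y ∈ Y₁, (w (y / x₀) : ℝ) ≤ #X * #Y₁ := by
      calc _ ≤ ∑ y ∈ Y₁, (#X : ℝ) := sum_le_sum fun y _ => by exact_mod_cast hwX _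
        _ = _ := by rw [sum_const, nsmul_eq_mul, mul_comm]
    have h4 : T = ∑ y ∈ Y₀, (w (y / x₀) : ℝ) := by rw [hTdef]; push_cast; rfl
    linarith
  have hpivot := card_dilations_le (X := X) (Y := Y) (Y₁ := Y₁) (x₀ := x₀) hΔ0 hD (by
      refine le_trans ?_ hmD
      have : (#Y₁ : ℝ) ≤ m := le_trans (by exact_mod_cast card_le_card hY₁Y) hYm
      exact pow_le_pow_left₀ (Nat.cast_nonneg _) this 2) hX hY₁Y (by
    intro y hy
    have hy1 := mem_filter.1 hy
    have hyΓ := (mem_filter.1 hy1.1).2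
    have hx00 := (h0 _ hyΓ).1
    refine ⟨(h0 _ hyΓ).2, (Γ.filter fun q => q.2 / q.1 = y / x₀).image Prod.fst, ?_, ?_, ?_⟩
    · intro u hu
      obtain ⟨q, hq, rfl⟩ := mem_image.1 hu
      exact (mem_product.1 (hΓ (mem_filter.1 hq).1)).1
    · rw [card_image_of_injOn, ← hw]
      · exact hy1.2
      · intro q hq q' hq' heq
        have h1 := mem_filter.1 (mem_coe.1 hq)
        have h2 := mem_filter.1 (mem_coe.1 hq')
        refine Prod.ext heq ?_
        rw [div_eq_iff (h0 _ h1.1).1] at h1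
        rw [div_eq_iff (h0 _ h2.1).1] at h2
        rw [h1.2, h2.2, heq]
    · intro u hu
      obtain ⟨q, hq, rfl⟩ := mem_image.1 hu
      have h1 := mem_filter.1 hq
      refine ⟨q.2, (mem_product.1 (hΓ h1.1)).2, ?_⟩
      have h2 := h1.2
      rw [div_eq_div_iff (h0 _ h1.1).1 hx00] at h2
      linear_combination -h2)
  generalize (#(X + Y) : ℝ) = S at hpivot ⊢
  have hY₁0 : (0 : ℝ) ≤ #Y₁ := Nat.cast_nonneg _
  generalize (#Y₁ : ℝ) = k at *
  generalize (#X : ℝ) = x at *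
  generalize (#Γ : ℝ) = τ at *
  -- Four factors T are rewritten as 2mΔ and three are bounded by 2xk, to match the exponents Δ⁴ and
  -- k³ of the pivot.
  have hT7 : T ^ 7 * x ≤ 2 ^ 27 * D * m ^ 4 * S ^ 10 := by
    calc T ^ 7 * x = T ^ 3 * (2 * m * Δ) ^ 4 * x := by
          have : 2 * m * Δ = T := by rw [hΔ]; field_simp
          rw [this]; ring
      _ ≤ (2 * (x * k)) ^ 3 * (2 * m * Δ) ^ 4 * x := by gcongr
      _ = 2 ^ 7 * m ^ 4 * (k ^ 3 * Δ ^ 4 * x ^ 4) := by ring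
      _ ≤ 2 ^ 7 * m ^ 4 * (2 ^ 20 * D * S ^ 10) := by gcongr
      _ = _ := by ring
  calc τ ^ 14 = (τ ^ 2) ^ 7 := by ring
    _ ≤ (m * x * T) ^ 7 := by gcongr
    _ = m ^ 7 * x ^ 6 * (T ^ 7 * x) := by ring
    _ ≤ m ^ 7 * x ^ 6 * (2 ^ 27 * D * m ^ 4 * S ^ 10) := by gcongr
    _ = _ := by ring

/-- Combination of the exponents of the Balog–Szemerédi–Gowers theorem and the pivot. -/
theorem le_of_grid_estimates {m g κ D x S τ : ℝ} (hm : 0 < m) (hg : 0 < g) (hκ : 0 < κ)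
    (hD : 0 ≤ D) (hS : 0 ≤ S) (h₁ : m ≤ 6 * g * x)
    (h₂ : x * m ≤ 4 * g * κ * τ) (h₃ : S * x ≤ 4096 * g ^ 4 * m ^ 2)
    (h₄ : τ ^ 14 ≤ 2 ^ 27 * D * m ^ 11 * x ^ 6 * S ^ 10) :
    m ≤ 2 ^ 222 * D * g ^ 72 * κ ^ 14 := by
  have hx0 : 0 < x := by
    by_contra! h
    have : 6 * g * x ≤ 0 := mul_nonpos_of_nonneg_of_nonpos (by positivity) h
    linarith
  have e1 : x ^ 18 * m ^ 14 ≤ 2 ^ 175 * D * g ^ 54 * κ ^ 14 * m ^ 31 := by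
    -- The factor x¹⁰ beyond (xm)¹⁴ pairs with S¹⁰, so that h₃ applies; the x⁶ supplied by h₄ then
    -- cancels.
    have : x ^ 6 * (x ^ 18 * m ^ 14) ≤ x ^ 6 * (2 ^ 175 * D * g ^ 54 * κ ^ 14 * m ^ 31) := by
      calc x ^ 6 * (x ^ 18 * m ^ 14) = (x * m) ^ 14 * x ^ 10 := by ring
        _ ≤ (4 * g * κ * τ) ^ 14 * x ^ 10 := by gcongr
        _ = (4 * g * κ) ^ 14 * τ ^ 14 * x ^ 10 := by ring
        _ ≤ (4 * g * κ) ^ 14 * (2 ^ 27 * D * m ^ 11 * x ^ 6 * S ^ 10) * x ^ 10 := by gcongr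
        _ = 2 ^ 55 * D * g ^ 14 * κ ^ 14 * m ^ 11 * x ^ 6 * (S * x) ^ 10 := by ring
        _ ≤ 2 ^ 55 * D * g ^ 14 * κ ^ 14 * m ^ 11 * x ^ 6 * (4096 * g ^ 4 * m ^ 2) ^ 10 := by
          gcongr
        _ = _ := by ring
    exact le_of_mul_le_mul_left this (by positivity)
  have e2 : m * m ^ 31 ≤ (2 ^ 222 * D * g ^ 72 * κ ^ 14) * m ^ 31 := by
    calc m * m ^ 31 = m ^ 18 * m ^ 14 := by ring
      _ ≤ (6 * g * x) ^ 18 * m ^ 14 := by gcongr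
      _ = 6 ^ 18 * g ^ 18 * (x ^ 18 * m ^ 14) := by ring
      _ ≤ 6 ^ 18 * g ^ 18 * (2 ^ 175 * D * g ^ 54 * κ ^ 14 * m ^ 31) := by gcongr
      _ = (6 ^ 18 * 2 ^ 175) * (D * g ^ 72 * κ ^ 14 * m ^ 31) := by ring
      _ ≤ 2 ^ 222 * (D * g ^ 72 * κ ^ 14 * m ^ 31) := by gcongr; norm_num
      _ = _ := by ring
  exact le_of_mul_le_mul_right e2 (by positivity)

end Grid

/-! ### Lines and projective coordinates -/

section Geometry

variable {F : Type*} [Field F]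

theorem IsLine.mem_iff {l : Set (F × F)} (hl : IsLine l) {q q' : F × F} (hq : q ∈ l)
    (hq' : q' ∈ l) (hne : q ≠ q') (x : F × F) :
    x ∈ l ↔ (q'.1 - q.1) * (x.2 - q.2) = (q'.2 - q.2) * (x.1 - q.1) := by
  obtain ⟨a, b, c, hab, rfl⟩ := hl
  simp only [Set.mem_ofPred_eq] at hq hq' ⊢
  have h : a * (q'.1 - q.1) + b * (q'.2 - q.2) = 0 := by linear_combination hq' - hq
  constructor
  · intro hx
    have hx' : a * (x.1 - q.1) + b * (x.2 - q.2) = 0 := by linear_combination hx - hq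
    rcases hab with ha | hb
    · apply mul_left_cancel₀ ha
      linear_combination (x.2 - q.2) * h - (q'.2 - q.2) * hx'
    · apply mul_left_cancel₀ hb
      linear_combination (q'.1 - q.1) * hx' - (x.1 - q.1) * h
  · intro hx
    by_cases hu : q'.1 - q.1 = 0
    · have hv : q'.2 - q.2 ≠ 0 := fun hv => hne (Prod.ext (sub_eq_zero.1 hu).symm
        (sub_eq_zero.1 hv).symm)
      have : a * x.1 + b * x.2 + c - (a * q.1 + b * q.2 + c) = 0 := by
        apply mul_left_cancel₀ hv
        linear_combination (x.2 - q.2) * h - a * hx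
      linear_combination this + hq
    · have : a * x.1 + b * x.2 + c - (a * q.1 + b * q.2 + c) = 0 := by
        apply mul_left_cancel₀ hu
        linear_combination (x.1 - q.1) * h + b * hx
      linear_combination this + hq

/-- Two lines with two common points coincide. -/
theorem IsLine.eq_of_mem {l l' : Set (F × F)} (hl : IsLine l) (hl' : IsLine l') {q q' : F × F}
    (hne : q ≠ q') (hq : q ∈ l) (hq' : q' ∈ l) (hql' : q ∈ l') (hql'' : q' ∈ l') : l = l' := by
  ext x
  rw [hl.mem_iff hq hq' hne, hl'.mem_iff hql' hql'' hne]

/-- Affine coordinates for which a given line is the second coordinate axis `v = 0`. -/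
theorem IsLine.exists_coordinates {l₀ : Set (F × F)} (h₀ : IsLine l₀) :
    ∃ u v : F × F → F, (∀ q, q ∈ l₀ ↔ v q = 0) ∧ (∀ q q', u q = u q' → v q = v q' → q = q') ∧
      ∀ l, IsLine l → ∃ a b c : F, (a ≠ 0 ∨ b ≠ 0) ∧ ∀ q, q ∈ l ↔ a * u q + b * v q + c = 0 := by
  obtain ⟨α, β, γ, hαβ, rfl⟩ := h₀
  by_cases hβ : β = 0
  · subst hβ
    have hα : α ≠ 0 := by simpa using hαβ
    refine ⟨fun q => q.2, fun q => α * q.1 + 0 * q.2 + γ, fun q => Iff.rfl, ?_, ?_⟩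
    · intro q q' h h'
      refine Prod.ext (mul_left_cancel₀ hα ?_) h
      linear_combination h'
    · rintro _ ⟨a, b, c, hab, rfl⟩
      refine ⟨b, a / α, c - a / α * γ, ?_, fun q => ?_⟩
      · rcases hab with ha | hb
        · exact Or.inr (div_ne_zero ha hα)
        · exact Or.inl hb
      · rw [Set.mem_ofPred_eq]
        have : b * q.2 + a / α * (α * q.1 + 0 * q.2 + γ) + (c - a / α * γ)
          = a * q.1 + b * q.2 + c := by field_simp; ring
        rw [this]
  · refine ⟨fun q => q.1, fun q => α * q.1 + β * q.2 + γ, fun q => Iff.rfl, ?_, ?_⟩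
    · intro q q' h h'
      refine Prod.ext h (mul_left_cancel₀ hβ ?_)
      linear_combination h' - α * h
    · rintro _ ⟨a, b, c, hab, rfl⟩
      refine ⟨a - b / β * α, b / β, c - b / β * γ, ?_, fun q => ?_⟩
      · by_cases hb : b = 0
        · subst hb
          left
          simpa using hab
        · exact Or.inr (div_ne_zero hb hβ)
      · rw [Set.mem_ofPred_eq]
        have : (a - b / β * α) * q.1 + b / β * (α * q.1 + β * q.2 + γ) + (c - b / β * γ)
          = a * q.1 + b * q.2 + c := by field_simp; ring
        rw [this]

/-- Projective coordinates in which the line `l₀` is at infinity and the pencils of lines through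
three of its points are the lines `x = const`, `y = const` and `x + y = const`. -/
theorem IsLine.exists_pencil_coordinates {l₀ : Set (F × F)} (h₀ : IsLine l₀) {q₁ q₂ q₃ : F × F}
    (h₁ : q₁ ∈ l₀) (h₂ : q₂ ∈ l₀) (h₃ : q₃ ∈ l₀) (h₁₂ : q₁ ≠ q₂) (h₁₃ : q₁ ≠ q₃) (h₂₃ : q₂ ≠ q₃) :
    ∃ x y : F × F → F, (∀ q q', q ∉ l₀ → q' ∉ l₀ → x q = x q' → y q = y q' → q = q') ∧
      (∀ l, IsLine l → ∀ q ∈ l, ∀ q' ∈ l, q ∉ l₀ → q' ∉ l₀ → (q₂ ∈ l → x q = x q') ∧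
        (q₁ ∈ l → y q = y q') ∧ (q₃ ∈ l → x q + y q = x q' + y q')) ∧
      ∀ l, IsLine l → q₁ ∉ l → q₂ ∉ l → ∃ ξ : F, ∀ q ∈ l, ∀ q' ∈ l, q ∉ l₀ → q' ∉ l₀ →
        y q - y q' = ξ * (x q - x q') ∧ (q ≠ q' → x q - x q' ≠ 0 ∧ y q - y q' ≠ 0) := by
  obtain ⟨u, v, hv, hinj, hline⟩ := h₀.exists_coordinates
  have hv₁ := (hv _).1 h₁
  have hv₂ := (hv _).1 h₂
  have hv₃ := (hv _).1 h₃
  obtain ⟨ν₁, hν₁⟩ : ∃ ν, ν = u q₁ := ⟨_, rfl⟩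
  obtain ⟨ν₂, hν₂⟩ : ∃ ν, ν = u q₂ := ⟨_, rfl⟩
  obtain ⟨ν₃, hν₃⟩ : ∃ ν, ν = u q₃ := ⟨_, rfl⟩
  have d₁₂ : ν₁ - ν₂ ≠ 0 := fun h => h₁₂ (hinj _ _ (by rw [← hν₁, ← hν₂, sub_eq_zero.1 h])
    (by rw [hv₁, hv₂]))
  have d₁₃ : ν₁ - ν₃ ≠ 0 := fun h => h₁₃ (hinj _ _ (by rw [← hν₁, ← hν₃, sub_eq_zero.1 h])
    (by rw [hv₁, hv₃]))
  have d₃₂ : ν₃ - ν₂ ≠ 0 := fun h => h₂₃ (hinj _ _ (by rw [← hν₂, ← hν₃, sub_eq_zero.1 h])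
    (by rw [hv₂, hv₃]))
  -- The scalars in x and y are chosen so that x + y = (ν₁ − ν₂)(u − ν₃)/v, which is constant on
  -- lines through q₃.
  obtain ⟨x, hx⟩ : ∃ x : F × F → F, ∀ q, x q = (ν₁ - ν₃) * ((u q - ν₂) / v q) :=
    ⟨_, fun _ => rfl⟩
  obtain ⟨y, hy⟩ : ∃ y : F × F → F, ∀ q, y q = (ν₃ - ν₂) * ((u q - ν₁) / v q) :=
    ⟨_, fun _ => rfl⟩
  -- Line equations stay linear in x and y; the two coefficients vanish exactly when the line passes
  -- through q₁ or q₂ respectively.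
  have key : ∀ a b c q, q ∉ l₀ → a * u q + b * v q + c = 0 →
      (c + a * ν₁) * (ν₃ - ν₂) * x q - (c + a * ν₂) * (ν₁ - ν₃) * y q
        = -(ν₁ - ν₂) * b * (ν₁ - ν₃) * (ν₃ - ν₂) := by
    intro a b c q hq h
    have hvq : v q ≠ 0 := fun h => hq ((hv _).2 h)
    rw [hx, hy]
    field_simp
    linear_combination (ν₁ - ν₂) * h
  have inj : ∀ q q', q ∉ l₀ → q' ∉ l₀ → x q = x q' → y q = y q' → q = q' := by
    intro q q' hq hq' hxx hyy
    have hvq : v q ≠ 0 := fun h => hq ((hv _).2 h)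
    have hvq' : v q' ≠ 0 := fun h => hq' ((hv _).2 h)
    rw [hx, hx] at hxx
    rw [hy, hy] at hyy
    have e1 := mul_left_cancel₀ d₁₃ hxx
    have e2 := mul_left_cancel₀ d₃₂ hyy
    rw [div_eq_div_iff hvq hvq'] at e1 e2
    have e3 : v q = v q' := by
      apply mul_left_cancel₀ d₁₂
      linear_combination e2 - e1
    refine hinj _ _ ?_ e3
    apply mul_right_cancel₀ hvq'
    rw [e3] at e1
    linear_combination e1
  refine ⟨x, y, inj, ?_, ?_⟩
  · intro l hl q hq q' hq' hq0 hq0'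
    obtain ⟨a, b, c, hab, hmem⟩ := hline l hl
    have hk := key a b c q hq0 ((hmem q).1 hq)
    have hk' := key a b c q' hq0' ((hmem q').1 hq')
    -- This degenerate equation would be l₀ itself, which misses q.
    have hac : ¬ (a = 0 ∧ c = 0) := by
      rintro ⟨rfl, rfl⟩
      have hb : b ≠ 0 := by simpa using hab
      have := (hmem q).1 hq
      simp only [zero_mul, zero_add, add_zero, mul_eq_zero, hb, false_or] at this
      exact hq0 ((hv q).2 this)
    have m₁ : q₁ ∈ l ↔ c + a * ν₁ = 0 := by
      rw [hmem, hv₁, ← hν₁, mul_zero, add_zero, add_comm]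
    have m₂ : q₂ ∈ l ↔ c + a * ν₂ = 0 := by
      rw [hmem, hv₂, ← hν₂, mul_zero, add_zero, add_comm]
    have m₃ : q₃ ∈ l ↔ c + a * ν₃ = 0 := by
      rw [hmem, hv₃, ← hν₃, mul_zero, add_zero, add_comm]
    refine ⟨fun h => ?_, fun h => ?_, fun h => ?_⟩
    · have e := m₂.1 h
      have hne : (c + a * ν₁) * (ν₃ - ν₂) ≠ 0 := by
        refine mul_ne_zero (fun e' => hac ?_) d₃₂
        have ha : a = 0 := by
          apply mul_right_cancel₀ d₁₂
          linear_combination e' - e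
        subst ha
        simpa using e
      apply mul_left_cancel₀ hne
      linear_combination hk - hk' + (ν₁ - ν₃) * (y q - y q') * e
    · have e := m₁.1 h
      have hne : (c + a * ν₂) * (ν₁ - ν₃) ≠ 0 := by
        refine mul_ne_zero (fun e' => hac ?_) d₁₃
        have ha : a = 0 := by
          apply mul_right_cancel₀ d₁₂
          linear_combination e - e'
        subst ha
        simpa using e
      apply mul_left_cancel₀ hne
      linear_combination hk' - hk + (ν₃ - ν₂) * (x q - x q') * e
    · have e := m₃.1 h
      have hne : a * (ν₁ - ν₃) * (ν₃ - ν₂) ≠ 0 := by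
        refine mul_ne_zero (mul_ne_zero (fun ha => hac ?_) d₁₃) d₃₂
        subst ha
        simpa using e
      apply mul_left_cancel₀ hne
      linear_combination hk - hk' -
        ((ν₃ - ν₂) * (x q - x q') - (ν₁ - ν₃) * (y q - y q')) * e
  · intro l hl h1 h2
    obtain ⟨a, b, c, hab, hmem⟩ := hline l hl
    have n₁ : (c + a * ν₁) * (ν₃ - ν₂) ≠ 0 := by
      refine mul_ne_zero (fun h => h1 ?_) d₃₂
      rw [hmem, hv₁, ← hν₁, mul_zero, add_zero, add_comm, h]
    have n₂ : (c + a * ν₂) * (ν₁ - ν₃) ≠ 0 := by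
      refine mul_ne_zero (fun h => h2 ?_) d₁₃
      rw [hmem, hv₂, ← hν₂, mul_zero, add_zero, add_comm, h]
    refine ⟨(c + a * ν₁) * (ν₃ - ν₂) / ((c + a * ν₂) * (ν₁ - ν₃)),
      fun q hq q' hq' hq0 hq0' => ?_⟩
    have hk := key a b c q hq0 ((hmem q).1 hq)
    have hk' := key a b c q' hq0' ((hmem q').1 hq')
    have e : (c + a * ν₂) * (ν₁ - ν₃) * (y q - y q')
        = (c + a * ν₁) * (ν₃ - ν₂) * (x q - x q') := by linear_combination hk' - hk
    refine ⟨?_, fun hne => ⟨fun hx0 => hne ?_, fun hy0 => hne ?_⟩⟩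
    · rw [div_mul_eq_mul_div, eq_div_iff n₂]
      linear_combination e
    · rw [hx0, mul_zero] at e
      exact inj _ _ hq0 hq0' (sub_eq_zero.1 hx0)
        (sub_eq_zero.1 ((mul_eq_zero.1 e).resolve_left n₂))
    · rw [hy0, mul_zero] at e
      exact inj _ _ hq0 hq0' (sub_eq_zero.1 ((mul_eq_zero.1 e.symm).resolve_left n₁))
        (sub_eq_zero.1 hy0)

end Geometry

/-! ### Double counting and popular collinear triples -/

section Counting

open Classical in
theorem card_pow_three_le_card_distinct_triples {β : Type*} (S : Finset β) :
    #S ^ 3 ≤ #((S ×ˢ S ×ˢ S).filter fun b => b.1 ≠ b.2.1 ∧ b.1 ≠ b.2.2 ∧ b.2.1 ≠ b.2.2)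
      + 3 * #S ^ 2 := by
  have h : S ×ˢ S ×ˢ S ⊆
      ((S ×ˢ S ×ˢ S).filter fun b => b.1 ≠ b.2.1 ∧ b.1 ≠ b.2.2 ∧ b.2.1 ≠ b.2.2) ∪
      ((S ×ˢ S).image (fun b => (b.1, b.1, b.2)) ∪ ((S ×ˢ S).image (fun b => (b.1, b.2, b.1)) ∪
        (S ×ˢ S).image (fun b => (b.2, b.1, b.1)))) := by
    rintro ⟨a, b, c⟩ h
    simp only [mem_product] at h
    by_cases hab : a = b
    · subst hab
      exact mem_union_right _ (mem_union_left _
        (mem_image.2 ⟨(a, c), mem_product.2 ⟨h.1, h.2.2⟩, rfl⟩))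
    by_cases hac : a = c
    · subst hac
      exact mem_union_right _ (mem_union_right _ (mem_union_left _
        (mem_image.2 ⟨(a, b), mem_product.2 ⟨h.1, h.2.1⟩, rfl⟩)))
    by_cases hbc : b = c
    · subst hbc
      exact mem_union_right _ (mem_union_right _ (mem_union_right _
        (mem_image.2 ⟨(b, a), mem_product.2 ⟨h.2.1, h.1⟩, rfl⟩)))
    · exact mem_union_left _ (mem_filter.2 ⟨by simp [h], hab, hac, hbc⟩)
  have c : ∀ f : β × β → β × β × β, #((S ×ˢ S).image f) ≤ #S ^ 2 := fun f =>
    card_image_le.trans (by rw [card_product, pow_two])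
  have h1 := (card_le_card h).trans (card_union_le _ _)
  have h2 := (card_union_le ((S ×ˢ S).image (fun b => (b.1, b.1, b.2)))
    ((S ×ˢ S).image (fun b => (b.1, b.2, b.1)) ∪ (S ×ˢ S).image (fun b => (b.2, b.1, b.1))))
  have h3 := (card_union_le ((S ×ˢ S).image (fun b => (b.1, b.2, b.1)))
    ((S ×ˢ S).image (fun b => (b.2, b.1, b.1))))
  have c1 := c (fun b => (b.1, b.1, b.2))
  have c2 := c (fun b => (b.1, b.2, b.1))
  have c3 := c (fun b => (b.2, b.1, b.1))
  have e : #(S ×ˢ S ×ˢ S) = #S ^ 3 := by rw [card_product, card_product]; ring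
  rw [e] at h1
  omega

open Classical in
/-- If the sets `W q ⊆ M` have `a` elements on average then some triple of distinct elements of `M`
lies in many of them. -/
theorem exists_popular_triple {α β : Type*} (P : Finset α) (M : Finset β) (W : α → Finset β)
    (hP : P.Nonempty) (hW : ∀ q ∈ P, W q ⊆ M) {a : ℝ} (ha : 4 ≤ a)
    (hsum : #P * a ≤ ∑ q ∈ P, (#(W q) : ℝ)) :
    ∃ b₁ ∈ M, ∃ b₂ ∈ M, ∃ b₃ ∈ M, b₁ ≠ b₂ ∧ b₁ ≠ b₃ ∧ b₂ ≠ b₃ ∧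
      ∃ G : Finset α, (∀ q, q ∈ G ↔ q ∈ P ∧ b₁ ∈ W q ∧ b₂ ∈ W q ∧ b₃ ∈ W q) ∧
        #P * a ^ 3 ≤ 4 * (#M : ℝ) ^ 3 * #G := by
  set T := (M ×ˢ M ×ˢ M).filter fun b => b.1 ≠ b.2.1 ∧ b.1 ≠ b.2.2 ∧ b.2.1 ≠ b.2.2 with hT
  obtain ⟨f, hf⟩ : ∃ f : β × β × β → ℕ, ∀ b, f b =
    #(P.filter fun q => b.1 ∈ W q ∧ b.2.1 ∈ W q ∧ b.2.2 ∈ W q) := ⟨_, fun _ => rfl⟩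
  have hP0 : (0 : ℝ) < #P := by exact_mod_cast hP.card_pos
  have hdouble : ∑ q ∈ P, (#(W q) : ℝ) ^ 3 ≤ ∑ b ∈ T, (f b : ℝ) + 3 * ∑ q ∈ P, (#(W q) : ℝ) ^ 2 := by
    have h1 := sum_card_filter_comm (fun q (b : β × β × β) => b.1 ∈ W q ∧ b.2.1 ∈ W q ∧ b.2.2 ∈ W q)
      P T
    simp_rw [← hf] at h1
    have h2 : ∀ q ∈ P, #(W q) ^ 3 ≤
        #(T.filter fun b => b.1 ∈ W q ∧ b.2.1 ∈ W q ∧ b.2.2 ∈ W q) + 3 * #(W q) ^ 2 := by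
      intro q hq
      refine (card_pow_three_le_card_distinct_triples (W q)).trans ?_
      refine Nat.add_le_add_right (card_le_card ?_) _
      intro b hb
      simp only [hT, mem_filter, mem_product] at hb ⊢
      have := hW q hq
      exact ⟨⟨⟨this hb.1.1, this hb.1.2.1, this hb.1.2.2⟩, hb.2⟩, hb.1⟩
    have h3 := sum_le_sum h2
    rw [sum_add_distrib, h1, ← mul_sum] at h3
    exact_mod_cast h3
  have hpm : #P * a ^ 3 ≤ ∑ q ∈ P, (#(W q) : ℝ) ^ 3 := by
    have := pow_sum_div_card_le_sum_pow (s := P) (f := fun q => (#(W q) : ℝ))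
      (fun _ _ => Nat.cast_nonneg _) 2
    refine le_trans ?_ this
    rw [le_div_iff₀ (by positivity)]
    calc #P * a ^ 3 * (#P : ℝ) ^ 2 = (#P * a) ^ 3 := by ring
      _ ≤ _ := pow_le_pow_left₀ (mul_nonneg hP0.le (by linarith)) hsum 3
  -- Termwise this is (w − 4)²(w + 2) ≥ 0. With a ≥ 4, the error 16|P| is at most a quarter of
  -- |P|a³, so distinct triples keep a quarter of the main term.
  have hpoly : ∑ q ∈ P, (#(W q) : ℝ) ^ 3 / 2 - 16 * #P ≤
      ∑ q ∈ P, (#(W q) : ℝ) ^ 3 - 3 * ∑ q ∈ P, (#(W q) : ℝ) ^ 2 := by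
    rw [mul_sum, ← sum_sub_distrib, mul_comm, ← nsmul_eq_mul, ← sum_const, ← sum_sub_distrib]
    refine sum_le_sum fun q _ => ?_
    have hw : (0 : ℝ) ≤ #(W q) := Nat.cast_nonneg _
    nlinarith [mul_nonneg (sq_nonneg ((#(W q) : ℝ) - 4)) (by linarith : (0 : ℝ) ≤ #(W q) + 2)]
  have ha3 : 64 ≤ a ^ 3 := by
    calc (64 : ℝ) = 4 ^ 3 := by norm_num
      _ ≤ a ^ 3 := by gcongr
  have hlow : #P * a ^ 3 ≤ 4 * ∑ b ∈ T, (f b : ℝ) := by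
    rw [← sum_div] at hpoly
    nlinarith
  have hTne : T.Nonempty := by
    rw [nonempty_iff_ne_empty]
    intro h
    rw [h, sum_empty] at hlow
    nlinarith
  obtain ⟨b, hb, hbf⟩ : ∃ b ∈ T, #P * a ^ 3 ≤ 4 * (#M : ℝ) ^ 3 * f b := by
    by_contra! hcon
    have h1 := sum_lt_sum_of_nonempty hTne hcon
    rw [← mul_sum, sum_const, nsmul_eq_mul] at h1
    have h2 : (#T : ℝ) ≤ (#M : ℝ) ^ 3 := by
      have : #T ≤ #M ^ 3 := (card_filter_le _ _).trans
        (by rw [card_product, card_product]; apply le_of_eq; ring)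
      exact_mod_cast this
    have h3 : (#T : ℝ) * (#P * a ^ 3) ≤ (#M : ℝ) ^ 3 * (4 * ∑ b ∈ T, (f b : ℝ)) :=
      mul_le_mul h2 hlow (mul_nonneg hP0.le (by linarith)) (pow_nonneg (Nat.cast_nonneg _) _)
    linarith
  have hb' := mem_filter.1 hb
  have hbm := hb'.1
  simp only [mem_product] at hbm
  rw [hf] at hbf
  exact ⟨b.1, hbm.1, b.2.1, hbm.2.1, b.2.2, hbm.2.2, hb'.2.1, hb'.2.2.1, hb'.2.2.2,
    _, fun q => mem_filter, hbf⟩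

variable {F : Type*} [Field F]

open Classical in
-- Distinct lines through q meet only in q, so the sets M l, which avoid q, are disjoint.
theorem sum_card_le_card_of_lines (𝓛 : Finset (Set (F × F))) (q : F × F)
    (M : Set (F × F) → Finset (F × F)) (Q : Finset (F × F)) (h : ∀ l ∈ 𝓛, IsLine l ∧ q ∈ l)
    (hM : ∀ l ∈ 𝓛, ∀ q' ∈ M l, q' ∈ l ∧ q' ≠ q ∧ q' ∈ Q) : ∑ l ∈ 𝓛, #(M l) ≤ #Q := by
  rw [← card_biUnion]
  · exact card_le_card (biUnion_subset.2 fun l hl q' hq' => (hM l hl q' hq').2.2)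
  · intro l hl l' hl' hne
    refine disjoint_left.2 fun q' hq' hq'' => hne ?_
    have h1 := hM l hl q' hq'
    have h2 := hM l' hl' q' hq''
    exact (h l hl).1.eq_of_mem (h l' hl').1 h1.2.1 h1.1 (h l hl).2 h2.1 (h l' hl').2

open Classical in
-- Each value of φ selects a line through q₀ on which φ takes it, and different values need
-- different lines. This bounds the numbers of values of x, y and x + y, and later of ratios, by a
-- degree.
theorem card_image_le_card_pencil {K : Type*} [DecidableEq K] (L : Finset (Set (F × F))) (G : Finset (F × F))
    (q₀ : F × F) (φ : F × F → K) (h : ∀ q ∈ G, ∃ l ∈ L, q ∈ l ∧ q₀ ∈ l)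
    (hφ : ∀ l ∈ L, q₀ ∈ l → ∀ q ∈ G, q ∈ l → ∀ q' ∈ G, q' ∈ l → φ q = φ q') :
    #(G.image φ) ≤ #(L.filter fun l => q₀ ∈ l) := by
  choose! f hfL hfq hf₀ using h
  choose! ψ hψG hψ using fun w (hw : w ∈ G.image φ) => mem_image.1 hw
  refine card_le_card_of_injOn (fun w => f (ψ w)) ?_ ?_
  · intro w hw
    exact mem_coe.2 (mem_filter.2 ⟨hfL _ (hψG w hw), hf₀ _ (hψG w hw)⟩)
  · intro w hw w' hw' heq
    simp only at heq
    rw [← hψ w hw, ← hψ w' hw']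
    exact hφ (f (ψ w)) (hfL _ (hψG w hw)) (hf₀ _ (hψG w hw)) _ (hψG w hw) (hfq _ (hψG w hw))
      _ (hψG w' hw') (heq ▸ hfq _ (hψG w' hw'))

open Classical in
/-- The points of `P` on `l₀` which are joined to the point `q` outside `l₀` by a line of `L`. -/
noncomputable def joinedOn (P : Finset (F × F)) (L : Finset (Set (F × F))) (l₀ : Set (F × F))
    (q : F × F) : Finset (F × F) :=
  P.filter fun q' => q' ∈ l₀ ∧ q ∉ l₀ ∧ ∃ l ∈ L, q ∈ l ∧ q' ∈ l

open Classical in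
-- Choose q' ≠ q on a line of L through q (at least s(t − 1) ways), then another line l₀ of L
-- through q' (at least s − 1 ways); l₀ cannot contain q, because two lines share at most one point.
theorem le_sum_card_joinedOn {P : Finset (F × F)} {L : Finset (Set (F × F))}
    (hL : ∀ l ∈ L, IsLine l) {s t : ℝ} (hs : 1 ≤ s) (ht : 1 ≤ t)
    (hP : ∀ q ∈ P, s ≤ #(L.filter fun l => q ∈ l))
    (hl : ∀ l ∈ L, t ≤ #(P.filter fun q => q ∈ l)) {q : F × F} (hq : q ∈ P) :
    s * (t - 1) * (s - 1) ≤ ∑ l₀ ∈ L, (#(joinedOn P L l₀ q) : ℝ) := by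
  set Q := P.filter fun q' => q' ≠ q ∧ ∃ l ∈ L, q ∈ l ∧ q' ∈ l with hQ
  have hQc : s * (t - 1) ≤ #Q := by
    have h1 := sum_card_le_card_of_lines (L.filter fun l => q ∈ l) q
      (fun l => (P.filter fun q' => q' ∈ l).erase q) Q
      (fun l hl => ⟨hL l (mem_filter.1 hl).1, (mem_filter.1 hl).2⟩) (by
        intro l hl q' hq'
        obtain ⟨hne, hq''⟩ := mem_erase.1 hq'
        obtain ⟨hqP, hql⟩ := mem_filter.1 hq''
        obtain ⟨hlL, hqqL⟩ := mem_filter.1 hl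
        exact ⟨hql, hne, mem_filter.2 ⟨hqP, hne, l, hlL, hqqL, hql⟩⟩)
    have h2 : ∑ l ∈ L.filter (fun l => q ∈ l), (t - 1) ≤
        ∑ l ∈ L.filter (fun l => q ∈ l), (#((P.filter fun q' => q' ∈ l).erase q) : ℝ) := by
      refine sum_le_sum fun l hl' => ?_
      obtain ⟨hlL, hql⟩ := mem_filter.1 hl'
      have h3 := hl l hlL
      have h4 := card_erase_add_one (mem_filter.2 ⟨hq, hql⟩ : q ∈ P.filter fun q' => q' ∈ l)
      have h5 : (#((P.filter fun q' => q' ∈ l).erase q) : ℝ) + 1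
        = #(P.filter fun q' => q' ∈ l) := by exact_mod_cast h4
      linarith
    rw [sum_const, nsmul_eq_mul] at h2
    calc s * (t - 1) ≤ #(L.filter fun l => q ∈ l) * (t - 1) :=
          mul_le_mul_of_nonneg_right (hP q hq) (by linarith)
      _ ≤ _ := h2
      _ ≤ #Q := by exact_mod_cast h1
  have hswap := sum_card_filter_comm
    (fun (l₀ : Set (F × F)) (q' : F × F) => q' ∈ l₀ ∧ q ∉ l₀ ∧ ∃ l ∈ L, q ∈ l ∧ q' ∈ l) L P
  have hswap' : ∑ l₀ ∈ L, (#(joinedOn P L l₀ q) : ℝ) = ∑ q' ∈ P,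
      (#(L.filter fun l₀ => q' ∈ l₀ ∧ q ∉ l₀ ∧ ∃ l ∈ L, q ∈ l ∧ q' ∈ l) : ℝ) := by
    unfold joinedOn
    exact_mod_cast hswap
  rw [hswap']
  have hterm : ∀ q' ∈ Q, s - 1 ≤
      (#(L.filter fun l₀ => q' ∈ l₀ ∧ q ∉ l₀ ∧ ∃ l ∈ L, q ∈ l ∧ q' ∈ l) : ℝ) := by
    intro q' hq'
    obtain ⟨hqP, hne, l, hlL, hql, hql'⟩ := mem_filter.1 hq'
    have hsub : (L.filter fun l₀ => q' ∈ l₀).erase l ⊆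
        L.filter fun l₀ => q' ∈ l₀ ∧ q ∉ l₀ ∧ ∃ l ∈ L, q ∈ l ∧ q' ∈ l := by
      intro l₀ hl₀
      obtain ⟨hne', hl₀'⟩ := mem_erase.1 hl₀
      obtain ⟨hl₀L, hq'l₀⟩ := mem_filter.1 hl₀'
      refine mem_filter.2 ⟨hl₀L, hq'l₀, fun h => hne' ?_, l, hlL, hql, hql'⟩
      exact (hL l₀ hl₀L).eq_of_mem (hL l hlL) hne hq'l₀ h hql' hql
    have h4 := card_erase_add_one
      (mem_filter.2 ⟨hlL, hql'⟩ : l ∈ L.filter fun l₀ => q' ∈ l₀)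
    have h5 : (#((L.filter fun l₀ => q' ∈ l₀).erase l) : ℝ) + 1
      = #(L.filter fun l₀ => q' ∈ l₀) := by exact_mod_cast h4
    have h6 : (#((L.filter fun l₀ => q' ∈ l₀).erase l) : ℝ) ≤
        #(L.filter fun l₀ => q' ∈ l₀ ∧ q ∉ l₀ ∧ ∃ l ∈ L, q ∈ l ∧ q' ∈ l) := by
      exact_mod_cast card_le_card hsub
    have := hP q' hqP
    linarith
  calc s * (t - 1) * (s - 1) ≤ #Q * (s - 1) :=
        mul_le_mul_of_nonneg_right hQc (by linarith)
    _ = ∑ q' ∈ Q, (s - 1) := by rw [sum_const, nsmul_eq_mul]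
    _ ≤ _ := sum_le_sum hterm
    _ ≤ _ := sum_le_sum_of_subset_of_nonneg (filter_subset _ _) fun _ _ _ => Nat.cast_nonneg _

open Classical in
/-- In a regular configuration there are three points on a line of `L` all of which are joined by
lines of `L` to each point of a large set `G`. -/
theorem exists_collinear_triple {P : Finset (F × F)} {L : Finset (Set (F × F))}
    (hL : ∀ l ∈ L, IsLine l) (hne : L.Nonempty) {N s t Λ : ℝ} (hLN : #L ≤ N)
    (hs : 4 ≤ s) (ht : 4 ≤ t) (hst : 16 * N ≤ s ^ 2 * t) (hΛ : 1 ≤ Λ)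
    (hP : ∀ q ∈ P, s ≤ #(L.filter fun l => q ∈ l))
    (hP' : ∀ q ∈ P, #(L.filter fun l => q ∈ l) ≤ Λ * s)
    (hl : ∀ l ∈ L, t ≤ #(P.filter fun q => q ∈ l))
    (hl' : ∀ l ∈ L, #(P.filter fun q => q ∈ l) ≤ Λ * t) :
    ∃ l₀ ∈ L, ∃ q₁ ∈ P, ∃ q₂ ∈ P, ∃ q₃ ∈ P, q₁ ∈ l₀ ∧ q₂ ∈ l₀ ∧ q₃ ∈ l₀ ∧
      q₁ ≠ q₂ ∧ q₁ ≠ q₃ ∧ q₂ ≠ q₃ ∧ ∃ G ⊆ P, (∀ q ∈ G, q ∉ l₀ ∧ (∃ l ∈ L, q ∈ l ∧ q₁ ∈ l) ∧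
        (∃ l ∈ L, q ∈ l ∧ q₂ ∈ l) ∧ ∃ l ∈ L, q ∈ l ∧ q₃ ∈ l) ∧
      s ^ 5 * t ≤ 256 * Λ ^ 4 * N ^ 2 * #G := by
  have hL0 : (0 : ℝ) < #L := by exact_mod_cast hne.card_pos
  have hPL : #L * t ≤ #P * (Λ * s) := by
    have h1 := sum_card_filter_comm (fun (q : F × F) (l : Set (F × F)) => q ∈ l) P L
    have h2 : ∑ l ∈ L, t ≤ ∑ l ∈ L, (#(P.filter fun q => q ∈ l) : ℝ) := sum_le_sum hl
    have h3 : ∑ q ∈ P, (#(L.filter fun l => q ∈ l) : ℝ) ≤ ∑ q ∈ P, Λ * s := sum_le_sum hP'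
    have h4 : ∑ q ∈ P, (#(L.filter fun l => q ∈ l) : ℝ)
      = ∑ l ∈ L, (#(P.filter fun q => q ∈ l) : ℝ) := by exact_mod_cast h1
    rw [sum_const, nsmul_eq_mul] at h2 h3
    linarith
  have hPne : P.Nonempty := by
    obtain ⟨l, hlL⟩ := hne
    have := hl l hlL
    rw [nonempty_iff_ne_empty]
    rintro rfl
    simp at this
    linarith
  -- The 4 comes from (s − 1)(t − 1) ≥ st/4; `hst` is what makes a ≥ 4.
  set a := s ^ 2 * t / (4 * #L) with ha
  have ha4 : 4 ≤ a := by
    rw [ha, le_div_iff₀ (by positivity)]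
    linarith
  obtain ⟨l₀, hl₀, hsum⟩ : ∃ l₀ ∈ L, #P * a ≤ ∑ q ∈ P, (#(joinedOn P L l₀ q) : ℝ) := by
    by_contra! hcon
    have h1 := sum_lt_sum_of_nonempty hne hcon
    rw [sum_comm, sum_const, nsmul_eq_mul] at h1
    have h2 : ∑ q ∈ P, s ^ 2 * t / 4 ≤ ∑ q ∈ P, ∑ l₀ ∈ L, (#(joinedOn P L l₀ q) : ℝ) := by
      refine sum_le_sum fun q hq => le_trans ?_
        (le_sum_card_joinedOn hL (by linarith) (by linarith) hP hl hq)
      have e1 : t / 2 ≤ t - 1 := by linarith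
      have e2 : s / 2 ≤ s - 1 := by linarith
      calc s ^ 2 * t / 4 = s * (t / 2) * (s / 2) := by ring
        _ ≤ s * (t - 1) * (s - 1) := by gcongr; nlinarith
    rw [sum_const, nsmul_eq_mul] at h2
    have h3 : #L * (#P * a) = #P * (s ^ 2 * t / 4) := by rw [ha]; field_simp
    linarith
  obtain ⟨q₁, h₁, q₂, h₂, q₃, h₃, h₁₂, h₁₃, h₂₃, G, hGmem, hG⟩ :=
    exists_popular_triple P
    (P.filter fun q => q ∈ l₀) (fun q => joinedOn P L l₀ q) hPne (by
      intro q _ q' hq'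
      unfold joinedOn at hq'
      rw [mem_filter] at hq' ⊢
      exact ⟨hq'.1, hq'.2.1⟩) ha4 hsum
  rw [mem_filter] at h₁ h₂ h₃
  refine ⟨l₀, hl₀, q₁, h₁.1, q₂, h₂.1, q₃, h₃.1, h₁.2, h₂.2, h₃.2, h₁₂, h₁₃, h₂₃,
    G, fun q hq => ((hGmem q).1 hq).1, ?_, ?_⟩
  rotate_left
  · have hM := hl' l₀ hl₀
    generalize (#G : ℝ) = g at hG ⊢
    have hM0 : (0 : ℝ) ≤ #(P.filter fun q => q ∈ l₀) := Nat.cast_nonneg _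
    generalize (#(P.filter fun q => q ∈ l₀) : ℝ) = M at hG hM hM0
    generalize (#L : ℝ) = ℓ at *
    have hp0 : (0 : ℝ) < #P := by exact_mod_cast hPne.card_pos
    generalize (#P : ℝ) = π at *
    have hg0 : 0 ≤ g := by
      by_contra! h
      have : 4 * M ^ 3 * g ≤ 0 := mul_nonpos_of_nonneg_of_nonpos (by positivity) h.le
      have : 0 < π * a ^ 3 := by positivity
      linarith
    have e1 : π * (s ^ 6 * t ^ 3) ≤ 256 * ℓ ^ 3 * (Λ * t) ^ 3 * g := by
      calc π * (s ^ 6 * t ^ 3) = 64 * ℓ ^ 3 * (π * a ^ 3) := by rw [ha]; field_simp; ring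
        _ ≤ 64 * ℓ ^ 3 * (4 * M ^ 3 * g) := by gcongr
        _ ≤ 64 * ℓ ^ 3 * (4 * (Λ * t) ^ 3 * g) := by gcongr
        _ = _ := by ring
    have e2 : (ℓ * t ^ 3 * s) * (s ^ 5 * t) ≤ (ℓ * t ^ 3 * s) * (256 * Λ ^ 4 * ℓ ^ 2 * g) := by
      calc (ℓ * t ^ 3 * s) * (s ^ 5 * t) = (ℓ * t) * (s ^ 6 * t ^ 3) := by ring
        _ ≤ (π * (Λ * s)) * (s ^ 6 * t ^ 3) := by gcongr
        _ = (Λ * s) * (π * (s ^ 6 * t ^ 3)) := by ring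
        _ ≤ (Λ * s) * (256 * ℓ ^ 3 * (Λ * t) ^ 3 * g) := by gcongr
        _ = _ := by ring
    refine (le_of_mul_le_mul_left e2 (by positivity)).trans ?_
    gcongr
  · intro q hq
    rw [hGmem] at hq
    simp only [mem_filter, joinedOn] at hq
    obtain ⟨-, a₁, a₂, a₃⟩ := hq
    exact ⟨a₁.2.2.1, a₁.2.2.2, a₂.2.2.2, a₃.2.2.2⟩

end Counting

/-! ### The bound for regular configurations -/

section Regular

open Classical in
-- At most two lines through q pass through q₁ or q₂. On each remaining line, at most q itself and
-- one point of l₀ are lost.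
theorem card_sub_two_mul_le {F : Type*} [Field F] {P : Finset (F × F)} {L : Finset (Set (F × F))}
    (hL : ∀ l ∈ L, IsLine l) {s t : ℝ} (ht : 2 ≤ t)
    (hl : ∀ l ∈ L, t ≤ #(P.filter fun q => q ∈ l)) {l₀ : Set (F × F)} (hl₀ : IsLine l₀)
    {q q₁ q₂ : F × F} (hq : s ≤ #(L.filter fun l => q ∈ l)) (hq₀ : q ∉ l₀) (h₁ : q ≠ q₁)
    (h₂ : q ≠ q₂) :
    (s - 2) * (t - 2) ≤ #(P.filter fun q' => q' ∉ l₀ ∧ q' ≠ q ∧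
      ∃ l ∈ L, q ∈ l ∧ q' ∈ l ∧ q₁ ∉ l ∧ q₂ ∉ l) := by
  set 𝓛 := L.filter fun l => q ∈ l ∧ q₁ ∉ l ∧ q₂ ∉ l with h𝓛
  have hone : ∀ q', q ≠ q' → #(L.filter fun l => q ∈ l ∧ q' ∈ l) ≤ 1 := by
    intro q' hne
    refine card_le_one.2 fun l hl l' hl' => ?_
    rw [mem_filter] at hl hl'
    exact (hL l hl.1).eq_of_mem (hL l' hl'.1) hne hl.2.1 hl.2.2 hl'.2.1 hl'.2.2
  have hc : s - 2 ≤ #𝓛 := by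
    have hsub : L.filter (fun l => q ∈ l) ⊆ 𝓛 ∪ (L.filter (fun l => q ∈ l ∧ q₁ ∈ l) ∪
        L.filter (fun l => q ∈ l ∧ q₂ ∈ l)) := by
      intro l hl
      simp only [h𝓛, mem_union, mem_filter] at hl ⊢
      tauto
    have e1 := (card_le_card hsub).trans (card_union_le _ _)
    have e2 := card_union_le (L.filter (fun l => q ∈ l ∧ q₁ ∈ l))
      (L.filter (fun l => q ∈ l ∧ q₂ ∈ l))
    have e3 := hone _ h₁
    have e4 := hone _ h₂
    have e5 : #(L.filter fun l => q ∈ l) ≤ #𝓛 + 2 := by omega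
    have e6 : (#(L.filter fun l => q ∈ l) : ℝ) ≤ #𝓛 + 2 := by exact_mod_cast e5
    linarith
  have hsum := sum_card_le_card_of_lines 𝓛 q
    (fun l => P.filter fun q' => q' ∈ l ∧ q' ∉ l₀ ∧ q' ≠ q)
    (P.filter fun q' => q' ∉ l₀ ∧ q' ≠ q ∧ ∃ l ∈ L, q ∈ l ∧ q' ∈ l ∧ q₁ ∉ l ∧ q₂ ∉ l)
    (fun l hl => ⟨hL l (mem_filter.1 hl).1, (mem_filter.1 hl).2.1⟩) (by
      intro l hl q' hq'
      obtain ⟨a, b⟩ := mem_filter.1 hl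
      obtain ⟨a', b'⟩ := mem_filter.1 hq'
      exact ⟨b'.1, b'.2.2, mem_filter.2 ⟨a', b'.2.1, b'.2.2, l, a, b.1, b'.1, b.2⟩⟩)
  have hM : ∀ l ∈ 𝓛, t - 2 ≤ (#(P.filter fun q' => q' ∈ l ∧ q' ∉ l₀ ∧ q' ≠ q) : ℝ) := by
    intro l hl'
    obtain ⟨hlL, hql, -⟩ := mem_filter.1 hl'
    have hsub : P.filter (fun q' => q' ∈ l) ⊆ P.filter (fun q' => q' ∈ l ∧ q' ∉ l₀ ∧ q' ≠ q) ∪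
        (P.filter (fun q' => q' ∈ l ∧ q' ∈ l₀) ∪ {q}) := by
      intro q' hq'
      simp only [mem_union, mem_filter, mem_singleton] at hq' ⊢
      tauto
    have e1 := (card_le_card hsub).trans (card_union_le _ _)
    have e2 := card_union_le (P.filter (fun q' => q' ∈ l ∧ q' ∈ l₀)) {q}
    have e3 : #(P.filter (fun q' => q' ∈ l ∧ q' ∈ l₀)) ≤ 1 := by
      refine card_le_one.2 fun a ha b hb => ?_
      rw [mem_filter] at ha hb
      by_contra hne
      have := (hL l hlL).eq_of_mem hl₀ hne ha.2.1 hb.2.1 ha.2.2 hb.2.2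
      exact hq₀ (this ▸ hql)
    rw [card_singleton] at e2
    have e5 : #(P.filter fun q' => q' ∈ l) ≤
      #(P.filter (fun q' => q' ∈ l ∧ q' ∉ l₀ ∧ q' ≠ q)) + 2 := by omega
    have e6 : (#(P.filter fun q' => q' ∈ l) : ℝ) ≤
      #(P.filter (fun q' => q' ∈ l ∧ q' ∉ l₀ ∧ q' ≠ q)) + 2 := by exact_mod_cast e5
    have := hl l hlL
    linarith
  calc (s - 2) * (t - 2) ≤ #𝓛 * (t - 2) := mul_le_mul_of_nonneg_right hc (by linarith)
    _ = ∑ l ∈ 𝓛, (t - 2) := by rw [sum_const, nsmul_eq_mul]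
    _ ≤ ∑ l ∈ 𝓛, (#(P.filter fun q' => q' ∈ l ∧ q' ∉ l₀ ∧ q' ≠ q) : ℝ) := sum_le_sum hM
    _ ≤ _ := by exact_mod_cast hsum

open Classical in
-- Averages the preceding count over centres in P. Avoiding q₁ and q₂ keeps the joining lines from
-- being axis-parallel in the new coordinates, so ratios seen from q₀ are defined and nonzero.
theorem exists_popular_center {F : Type*} [Field F] {P : Finset (F × F)}
    {L : Finset (Set (F × F))} (hL : ∀ l ∈ L, IsLine l) {N s t : ℝ} (hPN : #P ≤ N)
    (hs : 4 ≤ s) (ht : 4 ≤ t) (hN : 0 ≤ N) (hP : ∀ q ∈ P, s ≤ #(L.filter fun l => q ∈ l))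
    (hl : ∀ l ∈ L, t ≤ #(P.filter fun q => q ∈ l)) {l₀ : Set (F × F)} (hl₀ : IsLine l₀)
    {q₁ q₂ : F × F} (m₁ : q₁ ∈ l₀) (m₂ : q₂ ∈ l₀) (hne : P.Nonempty) {G : Finset (F × F)}
    (hGP : G ⊆ P) (hG : ∀ q ∈ G, q ∉ l₀) :
    ∃ q₀ ∈ P, ∃ H ⊆ G, #G * (s * t / 4) ≤ N * #H ∧ ∀ q ∈ H,
      q₀ ∉ l₀ ∧ q₀ ≠ q ∧ ∃ l ∈ L, q ∈ l ∧ q₀ ∈ l ∧ q₁ ∉ l ∧ q₂ ∉ l := by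
  suffices ∃ q₀ ∈ P, #G * (s * t / 4) ≤ N * #(G.filter fun q =>
      q₀ ∉ l₀ ∧ q₀ ≠ q ∧ ∃ l ∈ L, q ∈ l ∧ q₀ ∈ l ∧ q₁ ∉ l ∧ q₂ ∉ l) by
    obtain ⟨q₀, hq₀, h⟩ := this
    exact ⟨q₀, hq₀, _, filter_subset _ _, h, fun q hq => (mem_filter.1 hq).2⟩
  have hst : s * t / 4 ≤ (s - 2) * (t - 2) := by nlinarith
  have hdeg : ∀ q ∈ G, s * t / 4 ≤ #(P.filter fun q' => q' ∉ l₀ ∧ q' ≠ q ∧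
      ∃ l ∈ L, q ∈ l ∧ q' ∈ l ∧ q₁ ∉ l ∧ q₂ ∉ l) := fun q hq =>
    hst.trans (card_sub_two_mul_le hL (by linarith) hl hl₀ (hP q (hGP hq)) (hG q hq)
      (fun h => hG q hq (h ▸ m₁)) (fun h => hG q hq (h ▸ m₂)))
  have e2 := sum_card_filter_comm (fun q q' : F × F => q' ∉ l₀ ∧ q' ≠ q ∧
    ∃ l ∈ L, q ∈ l ∧ q' ∈ l ∧ q₁ ∉ l ∧ q₂ ∉ l) G P
  have e3 := sum_le_sum hdeg
  rw [sum_const, nsmul_eq_mul] at e3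
  have e4 : (#G : ℝ) * (s * t / 4) ≤ ∑ q' ∈ P, (#(G.filter fun q =>
      q' ∉ l₀ ∧ q' ≠ q ∧ ∃ l ∈ L, q ∈ l ∧ q' ∈ l ∧ q₁ ∉ l ∧ q₂ ∉ l) : ℝ) :=
    e3.trans (by exact_mod_cast e2.le)
  by_contra! hcon
  have e1 := sum_lt_sum_of_nonempty hne hcon
  rw [← mul_sum, sum_const, nsmul_eq_mul] at e1
  have e5 : #P * (#G * (s * t / 4)) ≤ N * (#G * (s * t / 4)) :=
    mul_le_mul_of_nonneg_right hPN (mul_nonneg (Nat.cast_nonneg _)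
      (div_nonneg (mul_nonneg (by linarith) (by linarith)) (by norm_num)))
  have e6 := mul_le_mul_of_nonneg_left e4 hN
  linarith

open Classical in
/-- The incidence bound for regular configurations of points and lines. -/
theorem le_of_regular {p : ℕ} [Fact p.Prime] {P : Finset (ZMod p × ZMod p)}
    {L : Finset (Set (ZMod p × ZMod p))} (hL : ∀ l ∈ L, IsLine l) (hne : L.Nonempty)
    {N s t Λ : ℝ} (hN : 0 < N) (hNp : N ≤ p) (hPN : #P ≤ N) (hLN : #L ≤ N)
    (hs : 4 ≤ s) (ht : 4 ≤ t) (hst : 16 * N ≤ s ^ 2 * t) (hΛ : 1 ≤ Λ)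
    (hP : ∀ q ∈ P, s ≤ #(L.filter fun l => q ∈ l))
    (hP' : ∀ q ∈ P, #(L.filter fun l => q ∈ l) ≤ Λ * s)
    (hl : ∀ l ∈ L, t ≤ #(P.filter fun q => q ∈ l))
    (hl' : ∀ l ∈ L, #(P.filter fun q => q ∈ l) ≤ Λ * t) :
    Λ * s ≤ 2 ^ 222 * (1 + (Λ * s) ^ 2 / N) * (256 * Λ ^ 6 * N ^ 2 / (s ^ 3 * t)) ^ 72 *
      (4 * N / (s * t)) ^ 14 := by
  obtain ⟨l₀, hl₀, q₁, h₁, q₂, h₂, q₃, h₃, m₁, m₂, m₃, h₁₂, h₁₃, h₂₃, G, hGP, hGl, hGc⟩ :=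
    exists_collinear_triple hL hne hLN hs ht hst hΛ hP hP' hl hl'
  obtain ⟨x, y, hinj, hpar, hslope⟩ :=
    (hL l₀ hl₀).exists_pencil_coordinates m₁ m₂ m₃ h₁₂ h₁₃ h₂₃
  have hs0 : 0 < s := by linarith
  have ht0 : 0 < t := by linarith
  have hΛ0 : 0 < Λ := by linarith
  set m := Λ * s with hm
  set g := 256 * Λ ^ 6 * N ^ 2 / (s ^ 3 * t) with hg
  set κ := 4 * N / (s * t) with hκ
  have hm0 : 0 < m := by positivity
  have hg0 : 0 < g := by positivity
  have hκ0 : 0 < κ := by positivity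
  have hEg : m ^ 2 ≤ g * #G := by
    have e : g * #G = Λ ^ 2 * (256 * Λ ^ 4 * N ^ 2 * #G) / (s ^ 3 * t) := by rw [hg]; ring
    rw [e, le_div_iff₀ (by positivity)]
    calc m ^ 2 * (s ^ 3 * t) = Λ ^ 2 * (s ^ 5 * t) := by rw [hm]; ring
      _ ≤ _ := by gcongr
  -- Because (x, y) is injective off l₀, G is identified with the edge set of a bipartite graph
  -- between its x-values and its y-values.
  obtain ⟨r, hr⟩ : ∃ r : ZMod p → ZMod p → Prop, ∀ a b, r a b ↔ ∃ q ∈ G, x q = a ∧ y q = b :=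
    ⟨_, fun _ _ => Iff.rfl⟩
  have hcount : ∀ X Y : Finset (ZMod p), ∑ a ∈ X, #(Y.filter fun b => r a b)
      = #(G.filter fun q => x q ∈ X ∧ y q ∈ Y) := by
    intro X Y
    have e : (X ×ˢ Y).filter (fun w => r w.1 w.2)
        = (G.filter fun q => x q ∈ X ∧ y q ∈ Y).image fun q => (x q, y q) := by
      ext ⟨a, b⟩
      simp only [hr, mem_filter, mem_product, mem_image, Prod.mk.injEq]
      constructor
      · rintro ⟨⟨ha, hb⟩, q, hq, rfl, rfl⟩
        exact ⟨q, ⟨hq, ha, hb⟩, rfl, rfl⟩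
      · rintro ⟨q, ⟨hq, ha, hb⟩, rfl, rfl⟩
        exact ⟨⟨ha, hb⟩, q, hq, rfl, rfl⟩
    have e' : #((G.filter fun q => x q ∈ X ∧ y q ∈ Y).image fun q => (x q, y q))
        = #(G.filter fun q => x q ∈ X ∧ y q ∈ Y) := by
      refine card_image_of_injOn fun q hq q' hq' heq => ?_
      have a := (mem_filter.1 (mem_coe.1 hq)).1
      have a' := (mem_filter.1 (mem_coe.1 hq')).1
      simp only [Prod.mk.injEq] at heq
      exact hinj q q' (hGl q a).1 (hGl q' a').1 heq.1 heq.2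
    rw [← e', ← e, card_filter, sum_product]
    exact sum_congr rfl fun a _ => by rw [card_filter]
  have hA : (#(G.image x) : ℝ) ≤ m := by
    refine le_trans ?_ (hP' q₂ h₂)
    exact_mod_cast card_image_le_card_pencil L G q₂ x (fun q hq => (hGl q hq).2.2.1)
      fun l hl h q hq hql q' hq' hql' =>
        (hpar l (hL l hl) q hql q' hql' (hGl q hq).1 (hGl q' hq').1).1 h
  have hB : (#(G.image y) : ℝ) ≤ m := by
    refine le_trans ?_ (hP' q₁ h₁)
    exact_mod_cast card_image_le_card_pencil L G q₁ y (fun q hq => (hGl q hq).2.1)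
      fun l hl h q hq hql q' hq' hql' =>
        (hpar l (hL l hl) q hql q' hql' (hGl q hq).1 (hGl q' hq').1).2.1 h
  have hS : (#(G.image fun q => x q + y q) : ℝ) ≤ m := by
    refine le_trans ?_ (hP' q₃ h₃)
    exact_mod_cast card_image_le_card_pencil L G q₃ (fun q => x q + y q)
      (fun q hq => (hGl q hq).2.2.2)
      fun l hl h q hq hql q' hq' hql' =>
        (hpar l (hL l hl) q hql q' hql' (hGl q hq).1 (hGl q' hq').1).2.2 h
  obtain ⟨X, hX, Y, hY, hXm, hXY, hsum⟩ := exists_small_sumset r (G.image x) (G.image y)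
    (G.image fun q => x q + y q) hm0 hg0 hA hB hS (by
      intro a _ b _ hab
      obtain ⟨q, hq, rfl, rfl⟩ := (hr a b).1 hab
      exact mem_image_of_mem (fun q => x q + y q) hq) (by
      have e : ∑ a ∈ G.image x, (#((G.image y).filter fun b => r a b) : ℝ) = #G := by
        have := hcount (G.image x) (G.image y)
        rw [filter_true_of_mem fun q hq => ⟨mem_image_of_mem x hq, mem_image_of_mem y hq⟩] at this
        exact_mod_cast this
      rw [e]
      exact hEg)
  set G' := G.filter fun q => x q ∈ X ∧ y q ∈ Y with hG'
  have hXY' : #X * m ≤ 4 * g * #G' := by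
    have e : ∑ a ∈ X, (#(Y.filter fun b => r a b) : ℝ) = #G' := by exact_mod_cast hcount X Y
    rwa [e] at hXY
  have hX0 : (0 : ℝ) < #X := by
    by_contra! h
    have : 6 * g * #X ≤ 0 := mul_nonpos_of_nonneg_of_nonpos (mul_nonneg (by norm_num) hg0.le) h
    linarith
  have hG'0 : (0 : ℝ) < #G' := by
    by_contra! h
    have h1 : 4 * g * #G' ≤ 0 := mul_nonpos_of_nonneg_of_nonpos (mul_nonneg (by norm_num) hg0.le) h
    have h2 := mul_pos hX0 hm0
    linarith
  have hG'G : ∀ q ∈ G', q ∈ G := fun q hq => (mem_filter.1 hq).1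
  obtain ⟨q₀, hq₀P, H, hHG', hq₀, hHr⟩ := exists_popular_center hL hPN hs ht hN.le hP hl (hL l₀ hl₀) m₁ m₂
    ⟨q₁, h₁⟩ (G := G') (fun q hq => hGP (hG'G q hq)) fun q hq => (hGl q (hG'G q hq)).1
  have hHmem : ∀ q ∈ H, q ∈ G' ∧
      q₀ ∉ l₀ ∧ q₀ ≠ q ∧ ∃ l ∈ L, q ∈ l ∧ q₀ ∈ l ∧ q₁ ∉ l ∧ q₂ ∉ l :=
    fun q hq => ⟨hHG' hq, hHr q hq⟩
  have hGH : (#G' : ℝ) ≤ κ * #H := by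
    rw [hκ, div_mul_eq_mul_div, le_div_iff₀ (by positivity)]
    linarith
  have hH0 : (0 : ℝ) < #H := by
    by_contra! h
    have : κ * #H ≤ 0 := mul_nonpos_of_nonneg_of_nonpos hκ0.le h
    linarith
  have hHne : H.Nonempty := card_pos.1 (by exact_mod_cast hH0)
  have hH₀ : ∀ q ∈ H, q ∉ l₀ := fun q hq => (hGl q (hG'G q (hHmem q hq).1)).1
  -- Translating q₀ to the origin turns lines of L through q₀ into ratios, at most m in number,
  -- without enlarging the sumset.
  set Γ := H.image fun q => (x q - x q₀, y q - y q₀) with hΓ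
  have hΓc : #Γ = #H := by
    refine card_image_of_injOn fun q hq q' hq' heq => ?_
    simp only [Prod.mk.injEq, sub_left_inj] at heq
    exact hinj q q' (hH₀ q hq) (hH₀ q' hq') heq.1 heq.2
  set X' := X.image fun a => a - x q₀ with hX'
  set Y' := Y.image fun b => b - y q₀ with hY'
  have hX'c : (#X' : ℝ) ≤ #X := by exact_mod_cast card_image_le
  have hY'c : (#Y' : ℝ) ≤ m := by
    refine le_trans ?_ hB
    exact_mod_cast card_image_le.trans (card_le_card hY)
  have hXY'c : (#(X' + Y') : ℝ) ≤ #(X + Y) := by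
    have : X' + Y' ⊆ (X + Y).image fun c => c - (x q₀ + y q₀) := by
      intro c hc
      obtain ⟨a, ha, b, hb, rfl⟩ := mem_add.1 hc
      obtain ⟨a', ha', rfl⟩ := mem_image.1 ha
      obtain ⟨b', hb', rfl⟩ := mem_image.1 hb
      exact mem_image.2 ⟨a' + b', add_mem_add ha' hb', by ring⟩
    exact_mod_cast (card_le_card this).trans card_image_le
  have hratio : (#(Γ.image fun w => w.2 / w.1) : ℝ) ≤ m := by
    refine le_trans ?_ (hP' q₀ hq₀P)
    rw [hΓ, image_image]
    exact_mod_cast card_image_le_card_pencil L H q₀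
      ((fun w : ZMod p × ZMod p => w.2 / w.1) ∘ fun q => (x q - x q₀, y q - y q₀))
      (fun q hq => by
        obtain ⟨-, -, -, l, hlL, hql, hq₀l, -⟩ := hHmem q hq
        exact ⟨l, hlL, hql, hq₀l⟩) (by
      intro l hlL hq₀l q hq hql q' hq' hql'
      obtain ⟨-, hq₀l₀, hne, l', hl'L, hql1, hq₀l1, hn1, hn2⟩ := hHmem q hq
      obtain ⟨-, -, hne', -⟩ := hHmem q' hq'
      have hll : l = l' := (hL l hlL).eq_of_mem (hL l' hl'L) hne hq₀l hql hq₀l1 hql1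
      subst hll
      obtain ⟨ξ, hξ⟩ := hslope l (hL l hlL) hn1 hn2
      obtain ⟨a1, a2⟩ := hξ q hql q₀ hq₀l (hH₀ q hq) hq₀l₀
      obtain ⟨b1, b2⟩ := hξ q' hql' q₀ hq₀l (hH₀ q' hq') hq₀l₀
      have a3 := (a2 hne.symm).1
      have b3 := (b2 hne'.symm).1
      simp only [Function.comp_apply]
      rw [a1, b1, mul_div_cancel_right₀ _ a3, mul_div_cancel_right₀ _ b3])
  -- As N ≤ p, this gives m² ≤ DN ≤ Dp without assuming m² ≤ p.
  set D := 1 + m ^ 2 / N with hD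
  have hD1 : 1 ≤ D := by
    have : 0 ≤ m ^ 2 / N := by positivity
    linarith
  have hDp : m ^ 2 ≤ D * p := by
    have : D * N = N + m ^ 2 := by rw [hD]; field_simp
    have h2 : D * N ≤ D * p := by gcongr
    linarith
  have hgrid := card_pow_le_of_card_ratios_le (X := X') (Y := Y') (Γ := Γ) (by
      intro w hw
      obtain ⟨q, hq, rfl⟩ := mem_image.1 hw
      have := (mem_filter.1 (hHmem q hq).1).2
      exact mem_product.2 ⟨mem_image_of_mem (fun a => a - x q₀) this.1,
        mem_image_of_mem (fun b => b - y q₀) this.2⟩) (hHne.image _) (by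
      intro w hw
      obtain ⟨q, hq, rfl⟩ := mem_image.1 hw
      obtain ⟨-, hq₀l₀, hne, l, hlL, hql, hq₀l, hn1, hn2⟩ := hHmem q hq
      obtain ⟨ξ, hξ⟩ := hslope l (hL l hlL) hn1 hn2
      exact (hξ q hql q₀ hq₀l (hH₀ q hq) hq₀l₀).2 hne.symm) hratio hY'c hD1 hDp
  rw [hΓc] at hgrid
  have hX'0 : (0 : ℝ) ≤ #X' := Nat.cast_nonneg _
  have hXY'0 : (0 : ℝ) ≤ #(X' + Y') := Nat.cast_nonneg _
  have hXY0 : (0 : ℝ) ≤ #(X + Y) := Nat.cast_nonneg _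
  generalize (#(X' + Y') : ℝ) = S' at *
  generalize (#(X + Y) : ℝ) = S at *
  generalize (#X' : ℝ) = ξ' at *
  generalize (#X : ℝ) = ξ at *
  generalize (#H : ℝ) = τ at *
  refine le_of_grid_estimates hm0 hg0 hκ0 (by linarith) hXY0 hXm (τ := τ) ?_ hsum
    (hgrid.trans ?_)
  · calc ξ * m ≤ _ := hXY'
      _ ≤ 4 * g * (κ * τ) := by gcongr
      _ = _ := by ring
  · gcongr

end Regular

/-! ### Regularization and optimization of exponents -/

section Incidences

theorem exists_dyadic_level {α : Type*} (A : Finset α) (f : α → ℕ) {k : ℕ} (hk : 0 < k)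
    (hf : ∀ x ∈ A, f x < 2 ^ k) :
    ∃ A' ⊆ A, ∃ M : ℕ, (∀ x ∈ A', M ≤ f x ∧ f x ≤ 2 * M) ∧ ∑ x ∈ A, f x ≤ k * ∑ x ∈ A', f x := by
  by_contra! hcon
  have h1 : ∀ i ∈ range k, k * ∑ x ∈ A with Nat.log 2 (f x) = i, f x < ∑ x ∈ A, f x := by
    intro i _
    -- Since `Nat.log 2 0 = 0`, zeros fall into level 0 with the ones; they must be removed for the
    -- lower bound, at no cost to the sum.
    have h := hcon (A.filter fun x => Nat.log 2 (f x) = i ∧ f x ≠ 0) (filter_subset _ _) (2 ^ i) (by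
      intro x hx
      obtain ⟨-, rfl, h0⟩ := mem_filter.1 hx
      have := Nat.lt_pow_succ_log_self (b := 2) (by norm_num) (f x)
      exact ⟨Nat.pow_log_le_self 2 h0, by rw [pow_succ] at this; omega⟩)
    rwa [← filter_filter, sum_filter_ne_zero] at h
  have h2 : ∑ i ∈ range k, ∑ x ∈ A with Nat.log 2 (f x) = i, f x = ∑ x ∈ A, f x :=
    sum_fiberwise_of_maps_to (fun x hx => mem_range.2 (by
      rcases eq_or_ne (f x) 0 with h0 | h0
      · simpa [h0] using hk
      · exact Nat.log_lt_of_lt_pow h0 (hf x hx))) f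
  have h3 := sum_lt_sum_of_nonempty ⟨0, mem_range.2 hk⟩ h1
  rw [← mul_sum, h2, sum_const, card_range, smul_eq_mul] at h3
  exact lt_irrefl _ h3

open Classical in
/-- A subconfiguration with large minimal degrees on both sides. -/
theorem exists_le_degrees {α β : Type*} (r : α → β → Prop) (P : Finset α) (L : Finset β) {s t : ℝ}
    (h : s * #P + t * #L < ∑ q ∈ P, (#(L.filter fun l => r q l) : ℝ)) (hs : 0 ≤ s) :
    ∃ P' ⊆ P, ∃ L' ⊆ L, L'.Nonempty ∧ (∀ q ∈ P', s ≤ #(L'.filter fun l => r q l)) ∧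
      ∀ l ∈ L', t ≤ #(P'.filter fun q => r q l) := by
  -- At a maximizer of edges − s|P'| − t|L'|, deleting a vertex of too small degree would increase
  -- the value. The maximum is positive, so L' is nonempty.
  obtain ⟨φ, hφ⟩ : ∃ φ : Finset α × Finset β → ℝ, ∀ w, φ w =
      ∑ q ∈ w.1, (#(w.2.filter fun l => r q l) : ℝ) - s * #w.1 - t * #w.2 := ⟨_, fun _ => rfl⟩
  obtain ⟨⟨P', L'⟩, hw, hmax⟩ := exists_max_image (P.powerset ×ˢ L.powerset) φ
    ⟨(P, L), mem_product.2 ⟨mem_powerset_self P, mem_powerset_self L⟩⟩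
  obtain ⟨hP', hL'⟩ := mem_product.1 hw
  simp only [mem_powerset] at hP' hL'
  refine ⟨P', hP', L', hL', ?_, fun q hq => ?_, fun l hl => ?_⟩
  · have h1 := hmax (P, L) (mem_product.2 ⟨mem_powerset_self P, mem_powerset_self L⟩)
    rw [nonempty_iff_ne_empty]
    rintro rfl
    rw [hφ, hφ] at h1
    simp only [filter_empty, card_empty, Nat.cast_zero, sum_const_zero] at h1
    have := mul_nonneg hs (Nat.cast_nonneg (α := ℝ) #P')
    linarith
  · have h1 := hmax (P'.erase q, L') (mem_product.2
      ⟨mem_powerset.2 ((erase_subset _ _).trans hP'), mem_powerset.2 hL'⟩)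
    rw [hφ, hφ] at h1
    have h2 := add_sum_erase P' (fun q => (#(L'.filter fun l => r q l) : ℝ)) hq
    have h3 : (#(P'.erase q) : ℝ) + 1 = #P' := by exact_mod_cast card_erase_add_one hq
    simp only at h1 h2
    rw [← h2, ← h3] at h1
    linarith
  · have h1 := hmax (P', L'.erase l) (mem_product.2
      ⟨mem_powerset.2 hP', mem_powerset.2 ((erase_subset _ _).trans hL')⟩)
    rw [hφ, hφ] at h1
    have e : ∀ M : Finset β, ∑ q ∈ P', (#(M.filter fun l => r q l) : ℝ)
        = ∑ l ∈ M, (#(P'.filter fun q => r q l) : ℝ) := fun M => by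
      exact_mod_cast sum_card_filter_comm r P' M
    have h2 := add_sum_erase L' (fun l => (#(P'.filter fun q => r q l) : ℝ)) hl
    have h3 : (#(L'.erase l) : ℝ) + 1 = #L' := by exact_mod_cast card_erase_add_one hl
    simp only [e] at h1 h2
    rw [← h2, ← h3] at h1
    linarith

open Classical in
/-- Every bipartite graph has an almost regular subgraph of comparable average degrees. -/
theorem exists_regular {α β : Type*} (r : α → β → Prop) (P : Finset α) (L : Finset β) {k : ℕ}
    (hk : 0 < k) (hP : #P < 2 ^ k) (hL : #L < 2 ^ k) {I : ℕ} (hI0 : 0 < I)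
    (hI : I = ∑ q ∈ P, #(L.filter fun l => r q l)) :
    ∃ P' ⊆ P, ∃ L' ⊆ L, L'.Nonempty ∧ ∃ s t : ℝ, 0 < s ∧ 0 < t ∧
      I ≤ 4 * k ^ 2 * s * #P ∧ I ≤ 4 * k ^ 2 * t * #L ∧
      (∀ q ∈ P', s ≤ #(L'.filter fun l => r q l)) ∧
      (∀ q ∈ P', #(L'.filter fun l => r q l) ≤ 8 * k * s) ∧
      (∀ l ∈ L', t ≤ #(P'.filter fun q => r q l)) ∧
      ∀ l ∈ L', #(P'.filter fun q => r q l) ≤ 8 * k * t := by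
  obtain ⟨P₁, hP₁, M, hM, hIM⟩ := exists_dyadic_level P (fun q => #(L.filter fun l => r q l)) hk
    fun _ _ => (card_filter_le _ _).trans_lt hL
  obtain ⟨L₁, hL₁, M', hM', hIM'⟩ := exists_dyadic_level L (fun l => #(P₁.filter fun q => r q l)) hk
    fun _ _ => ((card_filter_le _ _).trans (card_le_card hP₁)).trans_lt hP
  rw [← hI, sum_card_filter_comm r P₁ L] at hIM
  have hJ := sum_card_filter_comm r P₁ L₁
  have hMP : #P₁ * M ≤ ∑ l ∈ L, #(P₁.filter fun q => r q l) := by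
    rw [← sum_card_filter_comm r P₁ L]
    simpa using card_nsmul_le_sum P₁ _ M fun q hq => (hM q hq).1
  have hML : #L₁ * M' ≤ ∑ l ∈ L₁, #(P₁.filter fun q => r q l) := by
    simpa using card_nsmul_le_sum L₁ _ M' fun l hl => (hM' l hl).1
  obtain ⟨J, hJdef⟩ : ∃ J, J = ∑ l ∈ L₁, #(P₁.filter fun q => r q l) := ⟨_, rfl⟩
  rw [← hJdef] at hIM' hML hJ
  have hIJ : I ≤ k * (k * J) := hIM.trans (Nat.mul_le_mul_left k hIM')
  have hJ0 : 0 < J := by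
    rw [Nat.pos_iff_ne_zero]
    rintro rfl
    omega
  have hP0 : 0 < #P₁ := by
    rw [card_pos, nonempty_iff_ne_empty]
    rintro rfl
    simp at hJ
    omega
  have hL0 : 0 < #L₁ := by
    rw [card_pos, nonempty_iff_ne_empty]
    rintro rfl
    simp at hJdef
    omega
  have hP0' : (0 : ℝ) < #P₁ := by exact_mod_cast hP0
  have hL0' : (0 : ℝ) < #L₁ := by exact_mod_cast hL0
  have hJ0' : (0 : ℝ) < J := by exact_mod_cast hJ0
  have hk1 : (1 : ℝ) ≤ k := by exact_mod_cast hk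
  have hPP : (#P₁ : ℝ) ≤ #P := by exact_mod_cast card_le_card hP₁
  have hLL : (#L₁ : ℝ) ≤ #L := by exact_mod_cast card_le_card hL₁
  have hIJ' : (I : ℝ) ≤ k * (k * J) := by exact_mod_cast hIJ
  have hMJ : (#P₁ * M : ℝ) ≤ k * J := by exact_mod_cast hMP.trans hIM'
  have hMJ' : (#L₁ * M' : ℝ) ≤ J := by exact_mod_cast hML
  -- A quarter of each average degree: s|P₁| + t|L₁| = J/2 < J, as the deletion lemma needs.
  obtain ⟨s, hs⟩ : ∃ s : ℝ, s = J / (4 * #P₁) := ⟨_, rfl⟩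
  obtain ⟨t, ht⟩ : ∃ t : ℝ, t = J / (4 * #L₁) := ⟨_, rfl⟩
  have hs0 : 0 < s := hs ▸ div_pos hJ0' (mul_pos four_pos hP0')
  have ht0 : 0 < t := ht ▸ div_pos hJ0' (mul_pos four_pos hL0')
  have hsJ : 4 * s * #P₁ = J := by rw [hs]; field_simp
  have htJ : 4 * t * #L₁ = J := by rw [ht]; field_simp
  obtain ⟨P', hP', L', hL', hne, hPs, hLt⟩ := exists_le_degrees r P₁ L₁ (s := s) (t := t) (by
    have : ∑ q ∈ P₁, (#(L₁.filter fun l => r q l) : ℝ) = J := by exact_mod_cast hJ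
    rw [this]
    linarith) hs0.le
  have hMs : 2 * (M : ℝ) ≤ 8 * k * s := by
    rw [← hsJ] at hMJ
    have : (#P₁ : ℝ) * M ≤ #P₁ * (4 * k * s) := by linarith
    linarith [le_of_mul_le_mul_left this hP0']
  have hMt : 2 * (M' : ℝ) ≤ 8 * k * t := by
    rw [← htJ] at hMJ'
    have : (#L₁ : ℝ) * M' ≤ #L₁ * (4 * t) := by linarith
    have h1 := le_of_mul_le_mul_left this hL0'
    have h2 := mul_le_mul_of_nonneg_right hk1 ht0.le
    linarith
  refine ⟨P', hP'.trans hP₁, L', hL'.trans hL₁, hne, s, t, hs0, ht0, ?_, ?_, hPs, fun q hq => ?_,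
    hLt, fun l hl => ?_⟩
  · calc (I : ℝ) ≤ k * (k * J) := hIJ'
      _ = 4 * k ^ 2 * s * #P₁ := by rw [← hsJ]; ring
      _ ≤ _ := mul_le_mul_of_nonneg_left hPP
        (mul_nonneg (mul_nonneg zero_le_four (sq_nonneg _)) hs0.le)
  · calc (I : ℝ) ≤ k * (k * J) := hIJ'
      _ = 4 * k ^ 2 * t * #L₁ := by rw [← htJ]; ring
      _ ≤ _ := mul_le_mul_of_nonneg_left hLL
        (mul_nonneg (mul_nonneg zero_le_four (sq_nonneg _)) ht0.le)
  · refine le_trans ?_ hMs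
    exact_mod_cast (card_le_card (filter_subset_filter _ (hL'.trans hL₁))).trans (hM q (hP' hq)).2
  · refine le_trans ?_ hMt
    exact_mod_cast (card_le_card (filter_subset_filter _ hP')).trans (hM' l (hL' hl)).2

theorem le_mul_rpow_of_pow_le {σ B N e θ : ℝ} {k : ℕ} (hk : k ≠ 0) (hB : 1 ≤ B) (hN : 1 ≤ N)
    (h : σ ^ k ≤ B * N ^ e) (he : e ≤ θ * k) : σ ≤ B * N ^ θ := by
  have hN0 : 0 < N := by linarith
  have hθ : 0 ≤ N ^ θ := Real.rpow_nonneg hN0.le _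
  refine le_of_pow_le_pow_left₀ hk (mul_nonneg (by linarith) hθ) (h.trans ?_)
  rw [mul_pow, ← Real.rpow_natCast (N ^ θ), ← Real.rpow_mul hN0.le]
  exact mul_le_mul (le_self_pow₀ hB hk) (Real.rpow_le_rpow_of_exponent_le hN he)
    (Real.rpow_nonneg hN0.le _) (pow_nonneg (by linarith) _)

set_option exponentiation.threshold 1000 in
-- Clearing denominators gives s^231 t^86 ≲ N^158(1 + (Λs)²/N). If (Λs)² ≤ N the exponents add to
-- 317; otherwise the second term dominates, and cancelling s² leaves 315 against N^157.
theorem pow_min_le_or_pow_min_le {N s t Λ : ℝ} (hN : 0 < N) (hs : 0 < s) (ht : 0 < t) (hΛ : 1 ≤ Λ)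
    (h : Λ * s ≤ 2 ^ 222 * (1 + (Λ * s) ^ 2 / N) * (256 * Λ ^ 6 * N ^ 2 / (s ^ 3 * t)) ^ 72 *
      (4 * N / (s * t)) ^ 14) :
    min s t ^ 317 ≤ 2 ^ 827 * Λ ^ 433 * N ^ 158 ∨ min s t ^ 315 ≤ 2 ^ 827 * Λ ^ 433 * N ^ 157 := by
  have hΛ0 : 0 < Λ := by linarith
  have h1 : Λ * s ^ 231 * t ^ 86 ≤ 2 ^ 826 * Λ ^ 432 * N ^ 158 * (1 + (Λ * s) ^ 2 / N) := by
    rw [div_pow, div_pow, mul_div_assoc', mul_div_assoc', div_mul_eq_mul_div, div_div,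
      le_div_iff₀ (by positivity)] at h
    calc Λ * s ^ 231 * t ^ 86 = Λ * s * ((s ^ 3 * t) ^ 72 * (s * t) ^ 14) := by ring
      _ ≤ _ := h
      _ = _ := by ring
  have hσ : 0 < min s t := lt_min hs ht
  rcases le_total ((Λ * s) ^ 2) N with hc | hc
  · left
    have h2 : (Λ * s) ^ 2 / N ≤ 1 := (div_le_one hN).2 hc
    calc min s t ^ 317 = 1 * min s t ^ 231 * min s t ^ 86 := by ring
      _ ≤ Λ * s ^ 231 * t ^ 86 := by
        gcongr
        · exact min_le_left s t
        · exact min_le_right s t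
      _ ≤ 2 ^ 826 * Λ ^ 432 * N ^ 158 * (1 + 1) := h1.trans (by gcongr)
      _ = 2 ^ 827 * Λ ^ 432 * N ^ 158 := by ring
      _ ≤ _ := by
        gcongr
        norm_num
  · right
    have h2 : 1 ≤ (Λ * s) ^ 2 / N := (one_le_div hN).2 hc
    have h3 : Λ * s ^ 2 * (s ^ 229 * t ^ 86) ≤ Λ * s ^ 2 * (2 ^ 827 * Λ ^ 433 * N ^ 157) := by
      calc Λ * s ^ 2 * (s ^ 229 * t ^ 86) = Λ * s ^ 231 * t ^ 86 := by ring
        _ ≤ 2 ^ 826 * Λ ^ 432 * N ^ 158 * ((Λ * s) ^ 2 / N + (Λ * s) ^ 2 / N) :=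
          h1.trans (by gcongr)
        _ = _ := by field_simp; ring
    calc min s t ^ 315 = min s t ^ 229 * min s t ^ 86 := by ring
      _ ≤ s ^ 229 * t ^ 86 := by
        gcongr
        · exact min_le_left s t
        · exact min_le_right s t
      _ ≤ _ := le_of_mul_le_mul_left h3 (by positivity)

open Classical in
theorem incidences_eq_sum_card {F : Type*} (P : Finset (F × F)) (L : Finset (Set (F × F))) :
    incidences P L = ∑ q ∈ P, #(L.filter fun l => q ∈ l) :=
  sum_congr rfl fun _ _ => (card_filter _ _).symm

/-- The number of dyadic levels costs only a tiny power of N: log N ≤ 100000 N^(1/100000) and log 2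
≥ 1/2 give 200001 = 2 · 100000 + 1. -/
theorem log_add_one_le {N : ℝ} (hN : 1 ≤ N) :
    ((Nat.log 2 ⌊N⌋₊ + 1 : ℕ) : ℝ) ≤ 200001 * N ^ (1 / 100000 : ℝ) := by
  have hN0 : 0 < N := by linarith
  have hfl : ⌊N⌋₊ ≠ 0 := (Nat.floor_pos.2 hN).ne'
  have h1 : (2 : ℝ) ^ Nat.log 2 ⌊N⌋₊ ≤ N := by
    refine le_trans ?_ (Nat.floor_le hN0.le)
    exact_mod_cast Nat.pow_log_le_self 2 hfl
  have h2 : Nat.log 2 ⌊N⌋₊ * Real.log 2 ≤ Real.log N := by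
    rw [← Real.log_pow]
    exact Real.log_le_log (by positivity) h1
  have h3 := Real.log_le_rpow_div hN0.le (show (0 : ℝ) < 1 / 100000 by norm_num)
  have h4 : (1 : ℝ) ≤ N ^ (1 / 100000 : ℝ) := Real.one_le_rpow hN (by norm_num)
  have h5 : (1 / 2 : ℝ) ≤ Real.log 2 := by linarith [Real.log_two_gt_d9]
  have h6 := mul_le_mul_of_nonneg_left h5 (Nat.cast_nonneg (α := ℝ) (Nat.log 2 ⌊N⌋₊))
  rw [div_div_eq_mul_div, div_one] at h3
  push_cast
  linarith

set_option exponentiation.threshold 1000 in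
/-- The exponent is `165 / 331 = 1 / 2 - 1 / 662`, up to the loss of `2 / 100000` that pays for
the logarithmic factors of the regularization. -/
theorem min_degree_le {p : ℕ} [Fact p.Prime] {P : Finset (ZMod p × ZMod p)}
    {L : Finset (Set (ZMod p × ZMod p))} (hL : ∀ l ∈ L, IsLine l) (hne : L.Nonempty)
    {N s t Λ K : ℝ} (hN : 1 ≤ N) (hNp : N ≤ p) (hPN : #P ≤ N) (hLN : #L ≤ N)
    (hs0 : 0 < s) (ht0 : 0 < t) (hΛ : 1 ≤ Λ) (hK : 1 ≤ K) (hΛK : Λ ≤ K * N ^ (1 / 100000 : ℝ)) :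
    open Classical in
    (∀ q ∈ P, s ≤ #(L.filter fun l => q ∈ l)) → (∀ q ∈ P, #(L.filter fun l => q ∈ l) ≤ Λ * s) →
    (∀ l ∈ L, t ≤ #(P.filter fun q => q ∈ l)) → (∀ l ∈ L, #(P.filter fun q => q ∈ l) ≤ Λ * t) →
    min s t ≤ 2 ^ 827 * K ^ 433 * N ^ (165 / 331 - 2 / 100000 : ℝ) := by
  intro hP hP' hl hl'
  have hN0 : 0 < N := by linarith
  have hKp : 1 ≤ K ^ 433 := one_le_pow₀ hK
  have h827 : (64 : ℝ) ≤ 2 ^ 827 :=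
    le_trans (by norm_num : (64 : ℝ) ≤ 2 ^ 6) (pow_le_pow_right₀ (by norm_num) (by norm_num))
  have hB64 : (64 : ℝ) ≤ 2 ^ 827 * K ^ 433 := by nlinarith
  have hB : (1 : ℝ) ≤ 2 ^ 827 * K ^ 433 := by linarith
  have hσ : 0 < min s t := lt_min hs0 ht0
  -- The ranges where `le_of_regular` does not apply are harmless: they bound min s t by a constant,
  -- or its cube by 16N.
  by_cases hs4 : min s t < 4
  · refine le_mul_rpow_of_pow_le (k := 1) (e := 0) one_ne_zero hB hN ?_ (by norm_num)
    rw [Real.rpow_zero, pow_one]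
    linarith
  by_cases hst : s ^ 2 * t < 16 * N
  · refine le_mul_rpow_of_pow_le (k := 3) (e := 1) (by norm_num) hB hN ?_ (by norm_num)
    rw [Real.rpow_one]
    calc min s t ^ 3 = min s t ^ 2 * min s t := by ring
      _ ≤ s ^ 2 * t := by
        gcongr
        · exact min_le_left s t
        · exact min_le_right s t
      _ ≤ 16 * N := hst.le
      _ ≤ _ := by gcongr; linarith
  push Not at hs4 hst
  have key := le_of_regular hL hne hN0 hNp hPN hLN (hs4.trans (min_le_left s t))
    (hs4.trans (min_le_right s t)) hst hΛ hP hP' hl hl'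
  have hpow : Λ ^ 433 ≤ K ^ 433 * N ^ (433 / 100000 : ℝ) := by
    calc Λ ^ 433 ≤ (K * N ^ (1 / 100000 : ℝ)) ^ 433 := by gcongr
      _ = K ^ 433 * N ^ (433 / 100000 : ℝ) := by
        rw [mul_pow, ← Real.rpow_natCast (N ^ _), ← Real.rpow_mul hN0.le]
        norm_num
  have hfin : ∀ a : ℕ, 2 ^ 827 * Λ ^ 433 * N ^ a ≤
      2 ^ 827 * K ^ 433 * N ^ (a + 433 / 100000 : ℝ) := by
    intro a
    calc 2 ^ 827 * Λ ^ 433 * N ^ a ≤ 2 ^ 827 * (K ^ 433 * N ^ (433 / 100000 : ℝ)) * N ^ a := by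
          gcongr
      _ = _ := by rw [Real.rpow_add hN0, Real.rpow_natCast]; ring
  rcases pow_min_le_or_pow_min_le hN0 hs0 ht0 hΛ key with h | h
  · exact le_mul_rpow_of_pow_le (by norm_num) hB hN (h.trans (hfin 158)) (by norm_num)
  · exact le_mul_rpow_of_pow_le (by norm_num) hB hN (h.trans (hfin 157)) (by norm_num)

set_option exponentiation.threshold 1000 in
theorem incidences_le {p : ℕ} [Fact p.Prime] {P : Finset (ZMod p × ZMod p)}
    {L : Finset (Set (ZMod p × ZMod p))} (hL : ∀ l ∈ L, IsLine l) {N : ℝ} (hN : 1 ≤ N)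
    (hNp : N ≤ p) (hPN : #P ≤ N) (hLN : #L ≤ N) :
    (incidences P L : ℝ) ≤ 4 * 200001 ^ 2 * (2 ^ 827 * 1600008 ^ 433) *
      N ^ (3 / 2 - 1 / 662 : ℝ) := by
  have hN0 : 0 < N := by linarith
  rcases Nat.eq_zero_or_pos (incidences P L) with h0 | hI0
  · rw [h0, Nat.cast_zero]
    positivity
  obtain ⟨k, hk⟩ : ∃ k, k = Nat.log 2 ⌊N⌋₊ + 1 := ⟨_, rfl⟩
  have hkN : (k : ℝ) ≤ 200001 * N ^ (1 / 100000 : ℝ) := hk ▸ log_add_one_le hN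
  have hlt : ⌊N⌋₊ < 2 ^ k := hk ▸ Nat.lt_pow_succ_log_self (by norm_num) _
  have hk0 : 0 < k := by omega
  have hk1 : (1 : ℝ) ≤ k := by exact_mod_cast hk0
  obtain ⟨P', hP', L', hL', hne, s, t, hs0, ht0, hIs, hIt, h1, h2, h3, h4⟩ :=
    exists_regular (fun (q : ZMod p × ZMod p) (l : Set (ZMod p × ZMod p)) => q ∈ l) P L hk0
      ((Nat.le_floor hPN).trans_lt hlt) ((Nat.le_floor hLN).trans_lt hlt) hI0
      (incidences_eq_sum_card P L)
  have hPN' : (#P' : ℝ) ≤ N := le_trans (by exact_mod_cast card_le_card hP') hPN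
  have hLN' : (#L' : ℝ) ≤ N := le_trans (by exact_mod_cast card_le_card hL') hLN
  -- Here Λ = 8k, so K = 8 · 200001.
  have hσ := min_degree_le (fun l hl => hL l (hL' hl)) hne hN hNp hPN' hLN' hs0 ht0
    (Λ := 8 * k) (K := 1600008) (by linarith) (by norm_num) (by linarith) h1 h2 h3 h4
  have hI : (incidences P L : ℝ) ≤ 4 * k ^ 2 * min s t * N := by
    rcases min_choice s t with h | h <;> rw [h]
    · exact hIs.trans (by gcongr)
    · exact hIt.trans (by gcongr)
  have hexp : N ^ (3 / 2 - 1 / 662 : ℝ) = (N ^ (1 / 100000 : ℝ)) ^ 2 *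
      N ^ (165 / 331 - 2 / 100000 : ℝ) * N := by
    rw [← Real.rpow_natCast (N ^ _), ← Real.rpow_mul hN0.le, ← Real.rpow_add hN0,
      ← Real.rpow_add_one hN0.ne']
    norm_num
  rw [hexp]
  calc (incidences P L : ℝ) ≤ 4 * k ^ 2 * min s t * N := hI
    _ ≤ 4 * (200001 * N ^ (1 / 100000 : ℝ)) ^ 2 *
        (2 ^ 827 * 1600008 ^ 433 * N ^ (165 / 331 - 2 / 100000 : ℝ)) * N := by gcongr
    _ = _ := by ring

end Incidences

end PointsAndLines

theorem theorem4p1 :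
    ∀ ε : ℝ, 0 < ε → ∃ C : ℝ, 0 < C ∧
      ∀ (p : ℕ) [Fact p.Prime] (N : ℝ), N < (p : ℝ) →
        ∀ (P : Finset (ZMod p × ZMod p)) (L : Finset (Set (ZMod p × ZMod p))),
          (∀ l ∈ L, IsLine l) → (P.card : ℝ) ≤ N → (L.card : ℝ) ≤ N →
            (incidences P L : ℝ) ≤ C * (N ^ ((3 : ℝ) / 2 - 1 / 662)) ^ (1 + ε) := by
  intro ε hε
  refine ⟨4 * 200001 ^ 2 * (2 ^ 827 * 1600008 ^ 433), by positivity, ?_⟩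
  intro p _ N hNp P L hL hP hLN
  -- For N < 1 there are no points. For N ≥ 1 the bound without ε suffices, because its base is at
  -- least 1.
  rcases lt_or_ge N 1 with hN | hN
  · have hPe : P = ∅ := by
      rw [← Finset.card_eq_zero]
      have : (P.card : ℝ) < 1 := hP.trans_lt hN
      exact_mod_cast Nat.lt_one_iff.1 (by exact_mod_cast this)
    have hN0 : 0 ≤ N := le_trans (Nat.cast_nonneg _) hP
    have h0 : incidences P L = 0 := by rw [hPe]; rfl
    rw [h0, Nat.cast_zero]
    positivity
  · refine (incidences_le hL hN hNp.le hP hLN).trans ?_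
    refine mul_le_mul_of_nonneg_left ?_ (by positivity)
    exact Real.self_le_rpow_of_one_le (Real.one_le_rpow hN (by norm_num)) (by linarith)
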